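/- Let $n\ge 2$. The $n\times n\times n$ Rubik's Cube has $6n^2$ stickers. For each of the six faces $X\in\{F,B,R,L,U,D\}$ and each $1\le k\le\lfloor n/2\rfloor$ let $X_k$ be the clockwise $90^\circ$ rotation (as seen from outside that face) of the $k$-th slice counted from face $X$; for odd $n$ the three middle slices are not turned. Let $\mathbf M_n$ be the group of moves (formal words in the $X_k$ and their inverses), let $\varphi:\mathbf M_n\to \mathbf S_{6n^2}$ send a move to the permutation of the stickers that it induces, and let $\mathbf G=\varphi(\mathbf M_n)$ be the $n\times n\times n$ Rubik's Cube group. Let $\mathcal S_{\mathrm{conf}}\subset\mathbf S_{6n^2}$ be the set of all permutations of the stickers that can be obtained by disassembling the cube and reassembling its cubies (each cubie being moved as a rigid body), where a cubie may be put only in a place to which some move in $\mathbf M_n$ brings it. Then: 1. If $n$ is odd, $$|\mathbf G|=\frac{8!\cdot 3^7\cdot 12!\cdot 2^{11}\cdot (24!)^{\frac{(n-3)(n+1)}{4}}}{2^{\left(\frac{n-3}{2}\right)^2+\frac{n-3}{2}+1}}.$$ 2. If $n$ is even, $$|\mathbf G|=\frac{8!\cdot 3^7\cdot (24!)^{\frac{n(n-2)}{4}}}{2^{\left(\frac{n-2}{2}\right)^2}}.$$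 3. $\mathbf G$ acts on $\mathcal S_{\mathrm{conf}}$ by left multiplication $(g,s)\mapsto g\cdot s$, this action is free (if $g\cdot s=s$ for some $s\in\mathcal S_{\mathrm{conf}}$, then $g=\mathrm{id}$), and the number of its orbits is $|\mathcal S_{\mathrm{conf}}|/|\mathbf G|$. -/

import Mathlib

namespace RubiksCube

/-- A face of the cube: an axis (`0`, `1`, `2` stand for the right-handed axes `x`, `y`, `z`) and
the end of that axis (`true` is the positive end) at which the face lies. It also stands for the
outward unit normal of that face. -/
abbrev Face : Type := Fin 3 × Bool

/-- The positions of the `1 × 1 × 1` pieces of the `n × n × n` cube. -/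
abbrev Position (n : ℕ) : Type := Fin 3 → Fin n

/-- The piece at position `p` has a sticker on the face `f`. -/
def IsOuter {n : ℕ} (p : Position n) (f : Face) : Prop :=
  if f.2 = true then (p f.1 : ℕ) + 1 = n else (p f.1 : ℕ) = 0

instance {n : ℕ} (p : Position n) (f : Face) : Decidable (IsOuter p f) := by
  unfold IsOuter; infer_instance

/-- The sticker places of the cube: a position together with a face on which it lies. -/
abbrev Sticker (n : ℕ) : Type := {s : Position n × Face // IsOuter s.1 s.2}

/-- The position of the cubie that carries the sticker. -/
def Sticker.cubie {n : ℕ} (s : Sticker n) : Position n := s.1.1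

/-- The face on which the sticker is. -/
def Sticker.face {n : ℕ} (s : Sticker n) : Face := s.1.2

/-- The quarter turn of the whole cube about axis `a`, counterclockwise as seen from the positive
end of the axis, on positions: with `b = a + 1` and `c = a + 2` (mod 3) it is
`(x_b, x_c) ↦ (-x_c, x_b)`, coordinates being measured from the centre of the cube. -/
def turnPosition (n : ℕ) (a : Fin 3) : Equiv.Perm (Position n) where
  toFun p i := if i = a + 1 then (p (a + 2)).rev else if i = a + 2 then p (a + 1) else p i
  invFun p i := if i = a + 1 then p (a + 2) else if i = a + 2 then (p (a + 1)).rev else p i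
  left_inv p := by
    funext i
    fin_cases a <;> fin_cases i <;> simp
  right_inv p := by
    funext i
    fin_cases a <;> fin_cases i <;> simp

/-- The same quarter turn on faces: `e_b ↦ e_c` and `e_c ↦ -e_b`. -/
def turnFace (a : Fin 3) : Equiv.Perm Face where
  toFun f := if f.1 = a + 1 then (a + 2, f.2) else if f.1 = a + 2 then (a + 1, !f.2) else f
  invFun f := if f.1 = a + 1 then (a + 2, !f.2) else if f.1 = a + 2 then (a + 1, f.2) else f
  left_inv := by revert a; decide
  right_inv := by revert a; decide

theorem isOuter_turn {n : ℕ} (a : Fin 3) (p : Position n) (f : Face) :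
    IsOuter p f ↔ IsOuter (turnPosition n a p) (turnFace a f) := by
  obtain ⟨i, b⟩ := f
  have key : ∀ x : Fin n,
      ((x.rev : ℕ) + 1 = n ↔ (x : ℕ) = 0) ∧ ((x.rev : ℕ) = 0 ↔ (x : ℕ) + 1 = n) := by
    intro x
    have := x.2
    rw [Fin.val_rev]
    omega
  fin_cases a <;> fin_cases i <;> cases b <;>
    simp [IsOuter, turnPosition, turnFace, -Fin.val_rev, key]

/-- The quarter turn of the whole cube about axis `a` on stickers. -/
def turnSticker (n : ℕ) (a : Fin 3) : Equiv.Perm (Sticker n) :=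
  ((turnPosition n a).prodCongr (turnFace a)).subtypeEquiv fun s => isOuter_turn a s.1 s.2

theorem turnSticker_cubie_axis {n : ℕ} (a : Fin 3) (s : Sticker n) :
    (turnSticker n a s).cubie a = s.cubie a := by
  fin_cases a <;> simp [turnSticker, Sticker.cubie, turnPosition]

/-- The quarter turn of the single slice `{x_a = k}`, counterclockwise as seen from the positive
end of axis `a`; all other stickers stay in place. -/
def sliceTurn {n : ℕ} (a : Fin 3) (k : Fin n) : Equiv.Perm (Sticker n) where
  toFun s := if s.cubie a = k then turnSticker n a s else s
  invFun s := if s.cubie a = k then (turnSticker n a).symm s else s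
  left_inv s := by
    by_cases h : s.cubie a = k <;> simp [h, turnSticker_cubie_axis]
  right_inv s := by
    have h' : ((turnSticker n a).symm s).cubie a = s.cubie a := by
      rw [← turnSticker_cubie_axis, Equiv.apply_symm_apply]
    by_cases h : s.cubie a = k <;> simp [h, h']

/-- The slice rotations `F_k, B_k, R_k, L_k, U_k, D_k` with `1 ≤ k ≤ ⌊n / 2⌋`: a face and a depth
(the number `k - 1`). For odd `n` the middle slices are not among them. -/
abbrev SliceRotation (n : ℕ) : Type := Face × Fin (n / 2)

/-- The permutation of the stickers induced by a slice rotation: a quarter turn of the slice at the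
given depth below the face, clockwise as seen from outside that face. -/
def SliceRotation.perm {n : ℕ} (m : SliceRotation n) : Equiv.Perm (Sticker n) :=
  let k : Fin n := ⟨m.2, lt_of_lt_of_le m.2.2 (Nat.div_le_self n 2)⟩
  if m.1.2 = true then (sliceTurn m.1.1 k.rev)⁻¹ else sliceTurn m.1.1 k

/-- The group of moves: formal sequences of slice rotations and their inverses. -/
abbrev MoveGroup (n : ℕ) : Type := FreeGroup (SliceRotation n)

/-- The homomorphism that sends a move to the permutation of the stickers that it induces. -/
def stickerPerm (n : ℕ) : MoveGroup n →* Equiv.Perm (Sticker n) :=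
  FreeGroup.lift SliceRotation.perm

/-- The `n × n × n` Rubik's Cube group. -/
def cubeGroup (n : ℕ) : Subgroup (Equiv.Perm (Sticker n)) := (stickerPerm n).range

/-- The rotations of space that carry the cube to itself, as permutations of the six faces. -/
def rotationGroup : Subgroup (Equiv.Perm Face) := Subgroup.closure (Set.range turnFace)

/-- `π` moves the cubie at `p` as a rigid body to `q`, turning it by the rotation `ρ`. -/
def PlacesCubie {n : ℕ} (π : Equiv.Perm (Sticker n)) (p q : Position n)
    (ρ : Equiv.Perm Face) : Prop :=
  ∀ s : Sticker n, s.cubie = p → (π s).cubie = q ∧ (π s).face = ρ s.face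

/-- Some valid sequence of moves brings the cubie at `p` to the position `q`. -/
def SameOrbit {n : ℕ} (p q : Position n) : Prop :=
  ∃ g ∈ cubeGroup n, ∀ s : Sticker n, s.cubie = p → (g s).cubie = q

/-- The space of configurations: all permutations of the stickers that can be obtained by taking the
cube apart into its cubies and putting it together again (each cubie is moved as a rigid body),
where a cubie may only be put in a place to which some sequence of moves brings it. -/
def Configurations (n : ℕ) : Set (Equiv.Perm (Sticker n)) :=
  {π | ∀ p : Position n, ∃ q, SameOrbit p q ∧ ∃ ρ ∈ rotationGroup, PlacesCubie π p q ρ}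

theorem sliceTurn_places {n : ℕ} (a : Fin 3) (k : Fin n) (p : Position n) :
    ∃ q, ∃ ρ ∈ rotationGroup, PlacesCubie (sliceTurn a k) p q ρ := by
  by_cases h : p a = k
  · refine ⟨turnPosition n a p, turnFace a, Subgroup.subset_closure ⟨a, rfl⟩, ?_⟩
    rintro s rfl
    have e : sliceTurn a k s = turnSticker n a s := if_pos h
    rw [e]
    exact ⟨rfl, rfl⟩
  · refine ⟨p, 1, one_mem _, ?_⟩
    rintro s rfl
    have e : sliceTurn a k s = s := if_neg h
    rw [e]
    exact ⟨rfl, rfl⟩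

theorem sliceTurn_inv_places {n : ℕ} (a : Fin 3) (k : Fin n) (p : Position n) :
    ∃ q, ∃ ρ ∈ rotationGroup, PlacesCubie (sliceTurn a k)⁻¹ p q ρ := by
  by_cases h : p a = k
  · refine ⟨(turnPosition n a).symm p, (turnFace a)⁻¹,
      inv_mem (Subgroup.subset_closure ⟨a, rfl⟩), ?_⟩
    rintro s rfl
    have e : (sliceTurn a k)⁻¹ s = (turnSticker n a).symm s := if_pos h
    rw [e]
    exact ⟨rfl, rfl⟩
  · refine ⟨p, 1, one_mem _, ?_⟩
    rintro s rfl
    have e : (sliceTurn a k)⁻¹ s = s := if_neg h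
    rw [e]
    exact ⟨rfl, rfl⟩

theorem cubeGroup_places {n : ℕ} {g : Equiv.Perm (Sticker n)} (hg : g ∈ cubeGroup n)
    (p : Position n) : ∃ q, ∃ ρ ∈ rotationGroup, PlacesCubie g p q ρ := by
  obtain ⟨w, rfl⟩ := hg
  induction w using FreeGroup.induction_on generalizing p with
  | C1 =>
    refine ⟨p, 1, one_mem _, ?_⟩
    rintro s rfl
    rw [map_one]
    exact ⟨rfl, rfl⟩
  | of m =>
    simp only [stickerPerm, FreeGroup.lift_apply_of, SliceRotation.perm]
    split_ifs
    · exact sliceTurn_inv_places _ _ _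
    · exact sliceTurn_places _ _ _
  | inv_of m _ =>
    simp only [stickerPerm, map_inv, FreeGroup.lift_apply_of, SliceRotation.perm]
    split_ifs
    · rw [inv_inv]; exact sliceTurn_places _ _ _
    · exact sliceTurn_inv_places _ _ _
  | mul x y hx hy =>
    obtain ⟨q, ρ, hρ, h⟩ := hy p
    obtain ⟨q', ρ', hρ', h'⟩ := hx q
    refine ⟨q', ρ' * ρ, mul_mem hρ' hρ, fun s hs => ?_⟩
    rw [map_mul]
    have h1 := h s hs
    have h2 := h' _ h1.1
    refine ⟨h2.1, ?_⟩
    rw [Equiv.Perm.mul_apply, h2.2, h1.2, Equiv.Perm.mul_apply]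

theorem mul_mem_configurations {n : ℕ} {g s : Equiv.Perm (Sticker n)} (hg : g ∈ cubeGroup n)
    (hs : s ∈ Configurations n) : g * s ∈ Configurations n := by
  intro p
  obtain ⟨q, ⟨h, hh, hpq⟩, ρ, hρ, hp⟩ := hs p
  obtain ⟨q', ρ', hρ', hq⟩ := cubeGroup_places hg q
  refine ⟨q', ⟨g * h, mul_mem hg hh, fun t ht => (hq _ (hpq t ht)).1⟩, ρ' * ρ,
    mul_mem hρ' hρ, fun t ht => ?_⟩
  have h1 := hp t ht
  have h2 := hq _ h1.1
  refine ⟨h2.1, ?_⟩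
  rw [Equiv.Perm.mul_apply, h2.2, h1.2, Equiv.Perm.mul_apply]

/-- The left action `(g, s) ↦ g · s` of the cube group on the space of configurations. -/
instance configurationAction (n : ℕ) : MulAction (cubeGroup n) (Configurations n) where
  smul g s := ⟨g.1 * s.1, mul_mem_configurations g.2 s.2⟩
  one_smul s := Subtype.ext (one_mul s.1)
  mul_smul g h s := Subtype.ext (mul_assoc g.1 h.1 s.1)

/-- The number of orbits of the cube group on the space of configurations. -/
noncomputable def numOrbits (n : ℕ) : ℕ :=
  Nat.card (MulAction.orbitRel.Quotient (cubeGroup n) (Configurations n))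

end RubiksCube

/-!
Every sticker that is not the central one of its face is described by a right-handed frame of face
normals and two depths: it lies on the face of the first vector, and at depths `i` and `j` below the
faces of the other two (`stickerAt`). The rotations of the cube act freely on frames, so the
stickers fall into orbits of 24 elements, one for each pair `(i, j)` with `i < n / 2` and `2 * j <
n`, and a turn of the slice at depth `k` below `f` rotates those frames in the orbit `(i, j)` whose
first, second or third vector is `f`, according to whether `k` equals `0`, `i` or `j` (`sliceAct`,
`stickerPerm_stickerAt`). All computations with turns therefore take place in a fixed set of 24
frames, whatever the size of the cube.

The orbit `(0, 0)` holds the corner stickers and, for odd `n`, the orbit of `0` and the middle depth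
holds the stickers of the middle edges. Only face turns move these, and they generate the group of
the `2 × 2 × 2` or the `3 × 3 × 3` cube. Its order is found in a product of wreath products
(`mem_range_prod_iff`): explicit sequences of turns give three-cycles and pairs of opposite twists,
and three-cycles generate the alternating group because the action on the places is primitive.

In each of the other orbits, up to the two stickers of a wing, which move together, some commutator
of a turn of an inner slice with a conjugate of another turn is a three-cycle in this orbit and
fixes the other orbits; where `j` is the depth of the middle slice, which is never turned, this is
true after a correction on other orbits. Since the action on the orbit is primitive, Jordan's
theorem yields all even permutations of that orbit alone (`alternatingGroup_le_isolated`). The signs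
on these orbits satisfy one law: the sign on the orbit `(i, j)` is the product of the parities of
the numbers of turns at the depths `0`, `i` and `j` (`sign_orbitHom`). Here the parity at depth `0`
is determined by the corners, the parities at the other depths are independent of the corners and
middle edges, and these data determine all signs. So the order of the cube group is the order of the
group of face turns, times a factor `2` for each inner depth, times `24! / 2` for each orbit
(`natCard_range_prod_freeOrbitsHom`). The cube group acts on configurations by multiplication in a
group, hence freely, which gives the number of orbits.
-/

namespace RubiksCube

/-! ### Frames and turns of slices -/

/-- The 24 right-handed orthonormal frames of face normals, encoded by their first two vectors; the
third one is `Frame.thd`. -/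
abbrev Frame : Type := {p : Face × Face // p.1.1 ≠ p.2.1}

namespace Frame

/-- The first vector of the frame. In `stickerAt` it is the face that carries the sticker. -/
def fst (t : Frame) : Face := t.1.1
/-- The second vector of the frame. -/
def snd (t : Frame) : Face := t.1.2
/-- The third vector of the frame, the cross product of the first two. -/
def thd (t : Frame) : Face :=
  if t.snd.1 = t.fst.1 + 1 then (t.fst.1 + 2, t.fst.2 == t.snd.2)
  else (t.fst.1 + 1, t.fst.2 != t.snd.2)

end Frame

/-- The clockwise quarter turn about `f`, as seen from outside that face, on faces. -/
def faceTurn (f : Face) : Equiv.Perm Face :=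
  if f.2 = true then (turnFace f.1)⁻¹ else turnFace f.1

theorem faceTurn_axis_ne_iff : ∀ f a b : Face,
    a.1 ≠ b.1 ↔ (faceTurn f a).1 ≠ (faceTurn f b).1 := by decide +kernel

/-- The clockwise quarter turn about `f` on frames. -/
def frameTurn (f : Face) : Equiv.Perm Frame :=
  ((faceTurn f).prodCongr (faceTurn f)).subtypeEquiv fun p => faceTurn_axis_ne_iff f p.1 p.2

/-- Whether the slice in question contains the sticker with frame `t`. The flags `x`, `y`, `z` say
whether the depth of the slice, counted from the face `f`, is the depth at which the sticker lies
below the first, second and third vector of its frame. -/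
def meets (x y z : Bool) (f : Face) (t : Frame) : Bool :=
  (x && decide (t.fst = f)) || (y && decide (t.snd = f)) || (z && decide (t.thd = f))

theorem meets_frameTurn : ∀ (x y z : Bool) (f : Face) (t : Frame),
    meets x y z f (frameTurn f t) = meets x y z f t := by decide +kernel

theorem meets_frameTurn_symm (x y z : Bool) (f : Face) (t : Frame) :
    meets x y z f ((frameTurn f).symm t) = meets x y z f t := by
  rw [← meets_frameTurn, Equiv.apply_symm_apply]

/-- A quarter turn of a slice counted from the face `f` on a single orbit of stickers, which is
identified with `Frame`. The flags are those of `meets`. -/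
def sliceAct (x y z : Bool) (f : Face) : Equiv.Perm Frame where
  toFun t := if meets x y z f t then frameTurn f t else t
  invFun t := if meets x y z f t then (frameTurn f).symm t else t
  left_inv t := by
    by_cases h : meets x y z f t = true <;> simp [h, meets_frameTurn]
  right_inv t := by
    by_cases h : meets x y z f t = true <;> simp [h, meets_frameTurn_symm]

/-! ### Primitivity and wreath products -/

open scoped Pointwise

/-- The points that arise from `x` by at most `k` rounds of applying the permutations in `S`. It is
irreducible so that unification does not evaluate it. -/
@[irreducible]
def reach {X : Type*} [DecidableEq X] (S : List (Equiv.Perm X)) (k : ℕ) (x : X) : Finset X :=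
  (fun C => S.foldr (fun s E => C.image s ∪ E) C)^[k] {x}

theorem reach_subset {X : Type*} [DecidableEq X] {S : List (Equiv.Perm X)} {C : Set X}
    (hC : ∀ s ∈ S, ∀ y ∈ C, s y ∈ C) {x : X} (hx : x ∈ C) (k : ℕ) : ↑(reach S k x) ⊆ C := by
  have step : ∀ E : Finset X, ↑E ⊆ C → ∀ T : List (Equiv.Perm X), T ⊆ S →
      ↑(T.foldr (fun (s : Equiv.Perm X) E' => E.image s ∪ E') E) ⊆ C := by
    intro E hE T hT
    induction T with
    | nil => simpa using hE
    | cons s T ih =>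
      rw [List.cons_subset] at hT
      simp only [List.foldr_cons, Finset.coe_union, Finset.coe_image, Set.union_subset_iff]
      exact ⟨by rintro _ ⟨y, hy, rfl⟩; exact hC s hT.1 y (hE hy), ih hT.2⟩
  unfold reach
  induction k with
  | zero => simpa using hx
  | succ k ih =>
    rw [Function.iterate_succ_apply']
    exact step _ ih S (List.Subset.refl S)

/-- A criterion that can be checked by evaluation: if the permutations in `S ⊆ G` connect `x₀` to
all points, and those of them that fix `x₀` connect `y₀` to all other points, then `G` is primitive.
The hypotheses make `G` two-transitive. -/
theorem isPreprimitive_of_reach {X : Type*} [Fintype X] [DecidableEq X]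
    {G : Subgroup (Equiv.Perm X)} (S : List (Equiv.Perm X)) (hS : ∀ s ∈ S, s ∈ G) (k : ℕ)
    (x₀ y₀ : X) (h₁ : ∀ y, y ∈ reach S k x₀)
    (h₂ : ∀ y, y ≠ x₀ → y ∈ reach (S.filter fun s => s x₀ = x₀) k y₀) :
    MulAction.IsPreprimitive G X := by
  have tr : ∀ y, ∃ g : G, g • x₀ = y := fun y => by
    refine reach_subset (C := {y | ∃ g : G, g • x₀ = y}) ?_ ⟨1, one_smul _ _⟩ k (h₁ y)
    rintro s hs _ ⟨g, rfl⟩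
    exact ⟨⟨s, hS s hs⟩ * g, mul_smul _ _ _⟩
  have st : ∀ y, y ≠ x₀ → ∃ g : G, g • x₀ = x₀ ∧ g • y₀ = y := fun y hy => by
    refine reach_subset (C := {y | ∃ g : G, g • x₀ = x₀ ∧ g • y₀ = y}) ?_
      ⟨1, one_smul _ _, one_smul _ _⟩ k (h₂ y hy)
    rintro s hs _ ⟨g, hg, rfl⟩
    rw [List.mem_filter, decide_eq_true_iff] at hs
    exact ⟨⟨s, hS s hs.1⟩ * g, by rw [mul_smul, hg]; exact hs.2, mul_smul _ _ _⟩
  have : MulAction.IsPretransitive G X := ⟨fun a b => by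
    obtain ⟨g, rfl⟩ := tr a
    obtain ⟨h, rfl⟩ := tr b
    exact ⟨h * g⁻¹, by rw [mul_smul, inv_smul_smul]⟩⟩
  refine MulAction.IsPreprimitive.of_isTrivialBlock_base x₀ fun {E} hx hE => ?_
  by_cases hsub : E.Subsingleton
  · exact Or.inl hsub
  right
  obtain ⟨y, hy, hne⟩ : ∃ y ∈ E, y ≠ x₀ := by
    by_contra! h
    exact hsub fun a ha b hb => (h a ha).trans (h b hb).symm
  -- An element that fixes `x₀` fixes each block through `x₀`.
  have fixE : ∀ g : G, g • x₀ = x₀ → g • E = E := fun g hg =>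
    hE.smul_eq_of_mem hx (by rw [hg]; exact hx)
  obtain ⟨g, hg, rfl⟩ := st y hne
  have hy₀ : y₀ ∈ E := by
    rw [← fixE g hg] at hy
    exact Set.smul_mem_smul_set_iff.1 hy
  refine Set.eq_univ_of_forall fun z => ?_
  by_cases hz : z = x₀
  · rwa [hz]
  obtain ⟨h, hh, rfl⟩ := st z hz
  rw [← fixE h hh]
  exact Set.smul_mem_smul_set hy₀

/-- A primitive group with a three-cycle contains the alternating group (Jordan), which is simple;
so a subgroup that is normalised by the primitive group and holds the three-cycle contains it,
too. -/
theorem alternatingGroup_le_of_conj_mem {X : Type*} [Fintype X] [DecidableEq X]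
    (hX : 5 ≤ Nat.card X) {G N : Subgroup (Equiv.Perm X)} (hG : MulAction.IsPreprimitive G X)
    (hNG : N ≤ G) (hN : ∀ g ∈ G, ∀ x ∈ N, g * x * g⁻¹ ∈ N) {c : Equiv.Perm X}
    (hc : c.IsThreeCycle) (hcN : c ∈ N) : alternatingGroup X ≤ N := by
  have hle := Equiv.Perm.alternatingGroup_le_of_isPreprimitive_of_isThreeCycle_mem hG hc (hNG hcN)
  have hs : IsSimpleGroup (alternatingGroup X) := alternatingGroup.isSimpleGroup hX
  have hn : (N.subgroupOf (alternatingGroup X)).Normal :=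
    ⟨fun x hx g => hN _ (hle g.2) _ hx⟩
  rw [← Subgroup.subgroupOf_eq_top]
  refine hn.eq_bot_or_eq_top.resolve_left fun h => hc.ne_one ?_
  have : (⟨c, hc.mem_alternatingGroup⟩ : alternatingGroup X) ∈
      N.subgroupOf (alternatingGroup X) := hcN
  rw [h, Subgroup.mem_bot] at this
  exact congrArg Subtype.val this

/-- The wreath product of `A` with the symmetric group of `B`: the states of a set `B` of cubies
each of which can be twisted by the elements of `A`. The value `w.left b` is the twist of the cubie
that arrives at `b`. -/
abbrev Wreath (A B : Type) [CommGroup A] : Type :=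
  SemidirectProduct (B → A) (Equiv.Perm B) mulAutArrow

namespace Wreath

open SemidirectProduct

variable {A B : Type} [CommGroup A]

theorem mul_left_apply (v w : Wreath A B) (b : B) :
    (v * w).left b = v.left b * w.left (v.right⁻¹ b) := rfl

theorem inv_left_apply (v : Wreath A B) (b : B) : v⁻¹.left b = (v.left (v.right b))⁻¹ := by
  rw [SemidirectProduct.inv_left]
  change (v.left (v.right⁻¹⁻¹ b))⁻¹ = _
  rw [inv_inv]

/-- The action on pairs of a place and an orientation. -/
def toPerm (A B : Type) [CommGroup A] : Wreath A B →* Equiv.Perm (B × A) where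
  toFun w :=
    { toFun := fun p => (w.right p.1, w.left (w.right p.1) * p.2)
      invFun := fun p => (w.right⁻¹ p.1, (w.left p.1)⁻¹ * p.2)
      left_inv := fun p => by simp
      right_inv := fun p => by simp }
  map_one' := by ext p <;> simp
  map_mul' v w := by
    ext p
    · simp
    · simp [mul_left_apply, mul_assoc]

theorem toPerm_apply (w : Wreath A B) (b : B) (a : A) :
    toPerm A B w (b, a) = (w.right b, w.left (w.right b) * a) := rfl

theorem toPerm_injective : Function.Injective (toPerm A B) := by
  rw [injective_iff_map_eq_one]
  intro w hw
  have h : ∀ b, w.right b = b ∧ w.left b = 1 := fun b => by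
    have := toPerm_apply w b 1
    rw [hw, Equiv.Perm.one_apply, Prod.mk.injEq] at this
    refine ⟨this.1.symm, ?_⟩
    have h2 := this.2
    rw [← this.1, mul_one] at h2
    exact h2.symm
  ext b
  · exact (h b).2
  · exact (h b).1

/-- The element that induces a permutation which is compatible with twisting on the spot. -/
def ofPerm (x : Equiv.Perm (B × A)) (h : ∀ b a, x (b, a) = ((x (b, 1)).1, (x (b, 1)).2 * a)) :
    Wreath A B where
  left b := (x ((x⁻¹ (b, 1)).1, 1)).2
  right :=
    { toFun := fun b => (x (b, 1)).1
      invFun := fun b => (x⁻¹ (b, 1)).1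
      left_inv := fun b => by
        have h' := h b (x (b, 1)).2⁻¹
        rw [mul_inv_cancel] at h'
        change (x.symm _).1 = b
        rw [← h', Equiv.symm_apply_apply]
      right_inv := fun b => by
        have h' := h (x⁻¹ (b, 1)).1 (x⁻¹ (b, 1)).2
        have e : x ((x⁻¹ (b, 1)).1, (x⁻¹ (b, 1)).2) = (b, 1) := x.apply_symm_apply _
        rw [e] at h'
        exact (congrArg Prod.fst h').symm }

theorem toPerm_ofPerm (x : Equiv.Perm (B × A))
    (h : ∀ b a, x (b, a) = ((x (b, 1)).1, (x (b, 1)).2 * a)) : toPerm A B (ofPerm x h) = x := by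
  ext1 ⟨b, a⟩
  rw [h, toPerm_apply]
  have e : (ofPerm x h).right⁻¹ ((ofPerm x h).right b) = b := (ofPerm x h).right.symm_apply_apply b
  refine Prod.ext rfl ?_
  change (x ((ofPerm x h).right⁻¹ ((ofPerm x h).right b), 1)).2 * a = _
  rw [e]

variable [Fintype B]

/-- The product of the twists of all cubies. -/
def totalTwist (A B : Type) [CommGroup A] [Fintype B] : Wreath A B →* A where
  toFun w := ∏ b, w.left b
  map_one' := by simp
  map_mul' v w := by
    simp only [mul_left_apply, Finset.prod_mul_distrib]
    congr 1
    exact Equiv.prod_comp v.right⁻¹ w.left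

theorem totalTwist_apply (w : Wreath A B) : totalTwist A B w = ∏ b, w.left b := rfl

variable [DecidableEq B]

/-- If `N` induces all even permutations of the places, never changes the total twist, and twists
some two cubies in opposite directions by a generator, then it contains everything that an even
permutation of the places and a trivial total twist allow. Conjugation by `N`, which is
two-transitive on the places, spreads the opposite twists to all pairs. -/
theorem mem_of_totalTwist_eq_one (hB : 4 ≤ Nat.card B) {N : Subgroup (Wreath A B)}
    (hN : N ≤ (totalTwist A B).ker)
    (halt : alternatingGroup B ≤ N.map rightHom) {a b : B} (hab : a ≠ b) {z : A}
    (hz : ∀ x : A, x ∈ Subgroup.zpowers z)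
    (hD : inl (Pi.mulSingle a z * Pi.mulSingle b z⁻¹) ∈ N) {w : Wreath A B}
    (h₁ : totalTwist A B w = 1) (h₂ : Equiv.Perm.sign w.right = 1) : w ∈ N := by
  -- Conjugation permutes the twists of a pure twist, since `A` is commutative.
  have conj : ∀ σ ∈ alternatingGroup B, ∀ x : B → A, inl x ∈ N →
      inl (fun c => x (σ⁻¹ c)) ∈ N := by
    intro σ hσ x hx
    obtain ⟨m, hm, rfl⟩ := halt hσ
    have : inl (fun c => x ((rightHom m)⁻¹ c)) =
        m * inl x * m⁻¹ := by
      ext c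
      · have h : m.right (m.right⁻¹ c) = c := m.right.apply_symm_apply c
        simp only [mul_left_apply, inv_left_apply, SemidirectProduct.left_inl,
          SemidirectProduct.mul_right, SemidirectProduct.right_inl, mul_one, h]
        rw [mul_comm (m.left c), mul_inv_cancel_right]
        rfl
      · simp
    rw [this]
    exact N.mul_mem (N.mul_mem hm hx) (N.inv_mem hm)
  have tr : ∀ c d : B, c ≠ d →
      inl (Pi.mulSingle c z * Pi.mulSingle d z⁻¹) ∈ N := by
    intro c d hcd
    have h2 : MulAction.IsMultiplyPretransitive (alternatingGroup B) B 2 := by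
      have := alternatingGroup.isMultiplyPretransitive B
      exact MulAction.isMultiplyPretransitive_of_le (n := Nat.card B - 2) (by omega) (by simp)
    obtain ⟨σ, h, h'⟩ := (MulAction.is_two_pretransitive_iff.1 h2) hab hcd
    have := conj σ.1 σ.2 _ hD
    convert this using 2
    subst h h'
    funext e
    simp [Pi.mulSingle_apply, Equiv.symm_apply_eq, Subgroup.smul_def]
  have all : ∀ (c d : B) (x : A),
      inl (Pi.mulSingle c x * Pi.mulSingle d x⁻¹) ∈ N := by
    intro c d x
    by_cases hcd : c = d
    · subst hcd
      rw [← Pi.mulSingle_mul, mul_inv_cancel, Pi.mulSingle_one, map_one]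
      exact N.one_mem
    obtain ⟨k, rfl⟩ := Subgroup.mem_zpowers_iff.1 (hz x)
    have := N.zpow_mem (tr c d hcd) k
    rwa [← map_zpow, mul_zpow, ← Pi.mulSingle_zpow, ← Pi.mulSingle_zpow, inv_zpow] at this
  have base : ∀ x : B → A, ∏ c, x c = 1 → inl x ∈ N := by
    intro x hx
    -- Collect all twists at the place `a`, where they cancel.
    have : x = ∏ c, (Pi.mulSingle c (x c) * Pi.mulSingle a (x c)⁻¹) := by
      rw [Finset.prod_mul_distrib, Finset.univ_prod_mulSingle]
      have h : ∏ c, Pi.mulSingle (M := fun _ : B => A) a (x c)⁻¹ = 1 := by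
        refine (map_prod (MonoidHom.mulSingle (fun _ : B => A) a) (fun c => (x c)⁻¹) _).symm.trans
          ?_
        rw [Finset.prod_inv_distrib, hx, inv_one, map_one]
      rw [h, mul_one]
    rw [this, ← Subgroup.mem_comap]
    exact Subgroup.prod_mem _ fun c _ => all c a (x c)
  obtain ⟨m, hm, hmw⟩ := halt (show w.right ∈ alternatingGroup B from h₂)
  -- Here `w * m⁻¹` moves no cubie and has trivial total twist.
  have hk : w = inl (w * m⁻¹).left * m := by
    have h : (w * m⁻¹).right = 1 := by
      rw [SemidirectProduct.mul_right, SemidirectProduct.inv_right, ← hmw]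
      exact mul_inv_cancel _
    have := inl_left_mul_inr_right (w * m⁻¹)
    rw [h, map_one, mul_one] at this
    rw [this, inv_mul_cancel_right]
  rw [hk]
  refine N.mul_mem (base _ ?_) hm
  have hm1 : totalTwist A B m = 1 := hN hm
  rw [← totalTwist_apply, map_mul, map_inv, h₁, hm1, inv_one, mul_one]

end Wreath

/-! ### The corners and edges of the `3 × 3 × 3` cube -/

open Wreath

/-- The clockwise quarter turn of the right face, as a letter of a word. -/
def Letter.R : Face × Bool := ((0, true), true)
/-- The counterclockwise quarter turn of the right face, as a letter of a word. -/
def Letter.R' : Face × Bool := ((0, true), false)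
/-- The clockwise quarter turn of the left face, as a letter of a word. -/
def Letter.L : Face × Bool := ((0, false), true)
/-- The counterclockwise quarter turn of the left face, as a letter of a word. -/
def Letter.L' : Face × Bool := ((0, false), false)
/-- The clockwise quarter turn of the back face, as a letter of a word. -/
def Letter.B : Face × Bool := ((1, true), true)
/-- The counterclockwise quarter turn of the back face, as a letter of a word. -/
def Letter.B' : Face × Bool := ((1, true), false)
/-- The clockwise quarter turn of the front face, as a letter of a word. -/
def Letter.F : Face × Bool := ((1, false), true)
/-- The counterclockwise quarter turn of the front face, as a letter of a word. -/
def Letter.F' : Face × Bool := ((1, false), false)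
/-- The clockwise quarter turn of the upper face, as a letter of a word. -/
def Letter.U : Face × Bool := ((2, true), true)
/-- The counterclockwise quarter turn of the upper face, as a letter of a word. -/
def Letter.U' : Face × Bool := ((2, true), false)
/-- The clockwise quarter turn of the lower face, as a letter of a word. -/
def Letter.D : Face × Bool := ((2, false), true)
/-- The counterclockwise quarter turn of the lower face, as a letter of a word. -/
def Letter.D' : Face × Bool := ((2, false), false)

/-- The corner cubies, given by the signs of their three coordinates. -/
abbrev Corner : Type := Bool × Bool × Bool
/-- The edge cubies of the `3 × 3 × 3` cube: the axis `a` parallel to the edge, and the signs of the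
coordinates along `a + 1` and `a + 2`. -/
abbrev Edge : Type := Fin 3 × Bool × Bool
/-- The orientations of a corner cubie. -/
abbrev C3 : Type := Multiplicative (ZMod 3)
/-- The orientations of an edge cubie. -/
abbrev C2 : Type := Multiplicative (ZMod 2)

/-- The sign of the vector of the frame that is parallel to the axis `a`. -/
def Frame.side (t : Frame) (a : Fin 3) : Bool :=
  if t.fst.1 = a then t.fst.2 else if t.snd.1 = a then t.snd.2 else t.thd.2

/-- The first two vectors of the frame at a corner whose vector number `p.2` lies on the axis
`2`. -/
def cornerFaces (p : Corner × C3) : Face × Face :=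
  let x : Face := (0, p.1.1)
  let y : Face := (1, p.1.2.1)
  let z : Face := (2, p.1.2.2)
  let q : Face × Face := if xor p.1.1 (xor p.1.2.1 p.1.2.2) then (x, y) else (y, x)
  if p.2.toAdd = 0 then (z, q.1) else if p.2.toAdd = 1 then (q.2, z) else q

theorem cornerFaces_axis_ne : ∀ p, (cornerFaces p).1.1 ≠ (cornerFaces p).2.1 := by decide +kernel

/-- Frames are corner stickers: a corner together with the number of the vector of the frame that
lies on the axis `2`. -/
def cornerEquiv : Frame ≃ Corner × C3 where
  toFun t := ((t.side 0, t.side 1, t.side 2),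
    Multiplicative.ofAdd (if t.fst.1 = 2 then 0 else if t.snd.1 = 2 then 1 else 2))
  invFun p := ⟨cornerFaces p, cornerFaces_axis_ne p⟩
  left_inv := by decide +kernel
  right_inv := by decide +kernel

/-- The first two vectors of the frame of the sticker of the edge `p.1` with number `p.2`; number
`0` is the one on the axis `a + 1`. -/
def edgeFaces (p : Edge × C2) : Face × Face :=
  if p.2.toAdd = 0 then ((p.1.1 + 1, p.1.2.1), (p.1.1 + 2, p.1.2.2))
  else ((p.1.1 + 2, p.1.2.2), (p.1.1 + 1, p.1.2.1))

theorem edgeFaces_axis_ne : ∀ p, (edgeFaces p).1.1 ≠ (edgeFaces p).2.1 := by decide +kernel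

/-- Frames are edge stickers: an edge together with one of its two faces. -/
def edgeEquiv : Frame ≃ Edge × C2 where
  toFun t := ((t.thd.1, t.side (t.thd.1 + 1), t.side (t.thd.1 + 2)),
    Multiplicative.ofAdd (if t.fst.1 = t.thd.1 + 1 then 0 else 1))
  invFun p := ⟨edgeFaces p, edgeFaces_axis_ne p⟩
  left_inv := by decide +kernel
  right_inv := by decide +kernel

/-- The action of the face turns on the corners. -/
def cornerHom : FreeGroup Face →* Wreath C3 Corner :=
  FreeGroup.lift fun f =>
    ofPerm (cornerEquiv.permCongr (sliceAct true true true f)) (by revert f; decide +kernel)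

/-- The action of the face turns on the edges of the `3 × 3 × 3` cube. -/
def edgeHom : FreeGroup Face →* Wreath C2 Edge :=
  FreeGroup.lift fun f =>
    ofPerm (edgeEquiv.permCongr (sliceAct true true false f)) (by revert f; decide +kernel)

theorem toPerm_cornerHom (w : FreeGroup Face) :
    toPerm C3 Corner (cornerHom w) =
      cornerEquiv.permCongrHom (FreeGroup.lift (sliceAct true true true) w) := by
  refine DFunLike.congr_fun (f := (toPerm C3 Corner).comp cornerHom)
    (g := cornerEquiv.permCongrHom.toMonoidHom.comp (FreeGroup.lift (sliceAct true true true)))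
    (FreeGroup.ext_hom _ _ fun f => ?_) w
  simp only [MonoidHom.comp_apply, cornerHom, FreeGroup.lift_apply_of, toPerm_ofPerm]
  rfl

theorem toPerm_edgeHom (w : FreeGroup Face) :
    toPerm C2 Edge (edgeHom w) =
      edgeEquiv.permCongrHom (FreeGroup.lift (sliceAct true true false) w) := by
  refine DFunLike.congr_fun (f := (toPerm C2 Edge).comp edgeHom)
    (g := edgeEquiv.permCongrHom.toMonoidHom.comp (FreeGroup.lift (sliceAct true true false)))
    (FreeGroup.ext_hom _ _ fun f => ?_) w
  simp only [MonoidHom.comp_apply, edgeHom, FreeGroup.lift_apply_of, toPerm_ofPerm]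
  rfl

theorem cornerHom_eq_one_iff (w : FreeGroup Face) :
    cornerHom w = 1 ↔ FreeGroup.lift (sliceAct true true true) w = 1 := by
  rw [← map_eq_one_iff _ (toPerm_injective (A := C3) (B := Corner)), toPerm_cornerHom,
    map_eq_one_iff _ (MulEquiv.injective _)]

theorem edgeHom_eq_one_iff (w : FreeGroup Face) :
    edgeHom w = 1 ↔ FreeGroup.lift (sliceAct true true false) w = 1 := by
  rw [← map_eq_one_iff _ (toPerm_injective (A := C2) (B := Edge)), toPerm_edgeHom,
    map_eq_one_iff _ (MulEquiv.injective _)]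

theorem sign_cornerHom_of : ∀ f, Equiv.Perm.sign (cornerHom (FreeGroup.of f)).right = -1 := by
  decide +kernel

theorem sign_edgeHom_of : ∀ f, Equiv.Perm.sign (edgeHom (FreeGroup.of f)).right = -1 := by
  decide +kernel

theorem totalTwist_cornerHom (w : FreeGroup Face) : totalTwist _ _ (cornerHom w) = 1 := by
  refine DFunLike.congr_fun (f := (totalTwist C3 Corner).comp cornerHom) (g := 1)
    (FreeGroup.ext_hom _ _ ?_) w
  decide +kernel

theorem totalTwist_edgeHom (w : FreeGroup Face) : totalTwist _ _ (edgeHom w) = 1 := by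
  refine DFunLike.congr_fun (f := (totalTwist C2 Edge).comp edgeHom) (g := 1)
    (FreeGroup.ext_hom _ _ ?_) w
  decide +kernel

theorem sign_cornerHom_eq_sign_edgeHom (w : FreeGroup Face) :
    Equiv.Perm.sign (cornerHom w).right = Equiv.Perm.sign (edgeHom w).right := by
  refine DFunLike.congr_fun (f := (Equiv.Perm.sign.comp SemidirectProduct.rightHom).comp cornerHom)
    (g := (Equiv.Perm.sign.comp SemidirectProduct.rightHom).comp edgeHom)
    (FreeGroup.ext_hom _ _ fun f => ?_) w
  exact (sign_cornerHom_of f).trans (sign_edgeHom_of f).symm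

open Letter in
/-- A sequence of turns that cycles three corners and fixes all edges. -/
def cornerCycle : FreeGroup Face := FreeGroup.mk [R, D, R', U, R, D', R', U']

open Letter in
/-- A sequence of turns that twists two corners in opposite directions and fixes all other corners
and all edges. -/
def cornerTwist : FreeGroup Face :=
  FreeGroup.mk [R', D', R, D, R', D', R, D, U, D', R', D, R, D', R', D, R, U']

open Letter in
/-- A sequence of turns that cycles three edges and fixes all corners. -/
def edgeCycle : FreeGroup Face := FreeGroup.mk [B, F', D, F, B', L, B, F', D', F, B', L']

open Letter in
/-- A sequence of turns that flips two edges and fixes all other edges and all corners. -/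
def edgeFlip : FreeGroup Face :=
  FreeGroup.mk [B, U, D', L, L, U, U, D, D, R, U, R', D', D', U', U', L', L', D, U', B', U']

theorem edgeHom_cornerCycle : edgeHom cornerCycle = 1 :=
  SemidirectProduct.ext (by decide +kernel) (by decide +kernel)

theorem edgeHom_cornerTwist : edgeHom cornerTwist = 1 :=
  SemidirectProduct.ext (by decide +kernel) (by decide +kernel)

theorem cornerHom_edgeCycle : cornerHom edgeCycle = 1 :=
  SemidirectProduct.ext (by decide +kernel) (by decide +kernel)

theorem cornerHom_edgeFlip : cornerHom edgeFlip = 1 :=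
  SemidirectProduct.ext (by decide +kernel) (by decide +kernel)

theorem cornerHom_cornerTwist : cornerHom cornerTwist =
    SemidirectProduct.inl (Pi.mulSingle (true, false, true) (Multiplicative.ofAdd 1) *
      Pi.mulSingle (true, true, true) (Multiplicative.ofAdd 1)⁻¹) :=
  SemidirectProduct.ext (by decide +kernel) (by decide +kernel)

theorem edgeHom_edgeFlip : edgeHom edgeFlip =
    SemidirectProduct.inl (Pi.mulSingle (0, true, true) (Multiplicative.ofAdd 1) *
      Pi.mulSingle (1, true, true) (Multiplicative.ofAdd 1)⁻¹) :=
  SemidirectProduct.ext (by decide +kernel) (by decide +kernel)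

theorem isThreeCycle_cornerCycle : (cornerHom cornerCycle).right.IsThreeCycle := by
  rw [← card_support_eq_three_iff]
  decide +kernel

theorem isThreeCycle_edgeCycle : (edgeHom edgeCycle).right.IsThreeCycle := by
  rw [← card_support_eq_three_iff]
  decide +kernel

/-- The six faces in a list. -/
def faces : List Face := [(0, true), (0, false), (1, true), (1, false), (2, true), (2, false)]

theorem isPreprimitive_corner :
    MulAction.IsPreprimitive (SemidirectProduct.rightHom.comp cornerHom).range Corner := by
  refine isPreprimitive_of_reach (faces.map fun f => (cornerHom (FreeGroup.of f)).right) ?_ 4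
    (true, true, true) (false, false, false) (by decide +kernel) (by decide +kernel)
  simp only [List.mem_map, forall_exists_index, and_imp, forall_apply_eq_imp_iff₂]
  exact fun f _ => ⟨FreeGroup.of f, rfl⟩

theorem isPreprimitive_edge :
    MulAction.IsPreprimitive (SemidirectProduct.rightHom.comp edgeHom).range Edge := by
  refine isPreprimitive_of_reach (faces.map fun f => (edgeHom (FreeGroup.of f)).right) ?_ 5
    (0, true, true) (0, false, false) (by decide +kernel) (by decide +kernel)
  simp only [List.mem_map, forall_exists_index, and_imp, forall_apply_eq_imp_iff₂]
  exact fun f _ => ⟨FreeGroup.of f, rfl⟩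

/-- Elements of even permutation and trivial total twist are induced by elements of the kernel of
`β`, provided that the kernel holds an element that induces a three-cycle of the places and one that
twists two cubies in opposite directions. -/
theorem mem_map_ker_of_isThreeCycle {Γ V A B : Type} [Group Γ] [Group V] [CommGroup A] [Fintype B]
    [DecidableEq B] (hB : 5 ≤ Nat.card B) (α : Γ →* Wreath A B) (β : Γ →* V)
    (hα : ∀ γ, totalTwist A B (α γ) = 1)
    (hp : MulAction.IsPreprimitive (SemidirectProduct.rightHom.comp α).range B)
    {γ : Γ} (hγ : (α γ).right.IsThreeCycle) (hγ' : β γ = 1) {δ : Γ} {a b : B} (hab : a ≠ b) {z : A}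
    (hz : ∀ x : A, x ∈ Subgroup.zpowers z)
    (hδ : α δ = SemidirectProduct.inl (Pi.mulSingle a z * Pi.mulSingle b z⁻¹)) (hδ' : β δ = 1)
    {w : Wreath A B} (h₁ : totalTwist A B w = 1) (h₂ : Equiv.Perm.sign w.right = 1) :
    w ∈ β.ker.map α := by
  refine mem_of_totalTwist_eq_one (le_trans (by norm_num) hB) ?_ ?_ hab hz
    (hδ ▸ Subgroup.mem_map_of_mem α hδ') h₁ h₂
  · rintro _ ⟨g, -, rfl⟩
    exact hα g
  · refine alternatingGroup_le_of_conj_mem hB hp ?_ ?_ hγ ⟨_, ⟨γ, hγ', rfl⟩, rfl⟩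
    · rintro _ ⟨_, ⟨g, -, rfl⟩, rfl⟩
      exact ⟨g, rfl⟩
    · rintro _ ⟨g, rfl⟩ _ ⟨_, ⟨h, hh, rfl⟩, rfl⟩
      refine ⟨_, ⟨g * h * g⁻¹, β.normal_ker.conj_mem h hh g, rfl⟩, ?_⟩
      simp only [map_mul, map_inv, MonoidHom.comp_apply]

theorem mem_zpowers_C3 (x : C3) : x ∈ Subgroup.zpowers (Multiplicative.ofAdd 1 : C3) := by
  have : ∀ x : C3, ∃ k : Fin 3, (Multiplicative.ofAdd 1 : C3) ^ (k : ℕ) = x := by decide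
  obtain ⟨k, rfl⟩ := this x
  exact Subgroup.npow_mem_zpowers _ _

theorem mem_zpowers_C2 (x : C2) : x ∈ Subgroup.zpowers (Multiplicative.ofAdd 1 : C2) := by
  have : ∀ x : C2, ∃ k : Fin 2, (Multiplicative.ofAdd 1 : C2) ^ (k : ℕ) = x := by decide
  obtain ⟨k, rfl⟩ := this x
  exact Subgroup.npow_mem_zpowers _ _

theorem mem_map_cornerHom {x : Wreath C3 Corner} (h₁ : totalTwist _ _ x = 1)
    (h₂ : Equiv.Perm.sign x.right = 1) : x ∈ edgeHom.ker.map cornerHom :=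
  mem_map_ker_of_isThreeCycle (by simp) cornerHom edgeHom totalTwist_cornerHom
    isPreprimitive_corner isThreeCycle_cornerCycle edgeHom_cornerCycle (by decide)
    (z := Multiplicative.ofAdd 1) mem_zpowers_C3 cornerHom_cornerTwist edgeHom_cornerTwist h₁ h₂

theorem mem_map_edgeHom {x : Wreath C2 Edge} (h₁ : totalTwist _ _ x = 1)
    (h₂ : Equiv.Perm.sign x.right = 1) : x ∈ cornerHom.ker.map edgeHom :=
  mem_map_ker_of_isThreeCycle (by simp) edgeHom cornerHom totalTwist_edgeHom
    isPreprimitive_edge isThreeCycle_edgeCycle cornerHom_edgeCycle (by decide)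
    (z := Multiplicative.ofAdd 1) mem_zpowers_C2 edgeHom_edgeFlip cornerHom_edgeFlip h₁ h₂

theorem mem_range_cornerHom_iff (x : Wreath C3 Corner) :
    x ∈ cornerHom.range ↔ totalTwist _ _ x = 1 := by
  constructor
  · rintro ⟨w, rfl⟩
    exact totalTwist_cornerHom w
  intro h
  have le : edgeHom.ker.map cornerHom ≤ cornerHom.range := by
    rintro _ ⟨w, -, rfl⟩
    exact ⟨w, rfl⟩
  rcases Int.units_eq_one_or (Equiv.Perm.sign x.right) with hs | hs
  · exact le (mem_map_cornerHom h hs)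
  -- A quarter turn changes the sign.
  · rw [← Subgroup.mul_mem_cancel_right _ (⟨FreeGroup.of (0, true), rfl⟩ :
      cornerHom (FreeGroup.of (0, true)) ∈ cornerHom.range)]
    refine le (mem_map_cornerHom ?_ ?_)
    · rw [map_mul, h, totalTwist_cornerHom, one_mul]
    · rw [SemidirectProduct.mul_right, map_mul, hs, sign_cornerHom_of]
      decide

/-- The laws of the `3 × 3 × 3` cube: a state of corners and edges can be reached if and only if the
corner twists and the edge flips cancel and the two permutations have the same sign. -/
theorem mem_range_prod_iff (x : Wreath C3 Corner × Wreath C2 Edge) :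
    x ∈ (cornerHom.prod edgeHom).range ↔ totalTwist _ _ x.1 = 1 ∧ totalTwist _ _ x.2 = 1 ∧
      Equiv.Perm.sign x.1.right = Equiv.Perm.sign x.2.right := by
  constructor
  · rintro ⟨w, rfl⟩
    exact ⟨totalTwist_cornerHom w, totalTwist_edgeHom w, sign_cornerHom_eq_sign_edgeHom w⟩
  have even : ∀ x : Wreath C3 Corner × Wreath C2 Edge, totalTwist _ _ x.1 = 1 →
      totalTwist _ _ x.2 = 1 → Equiv.Perm.sign x.1.right = 1 → Equiv.Perm.sign x.2.right = 1 →
      x ∈ (cornerHom.prod edgeHom).range := by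
    rintro ⟨x, y⟩ hx hy hx' hy'
    obtain ⟨v, hv, rfl⟩ := mem_map_cornerHom hx hx'
    obtain ⟨w, hw, rfl⟩ := mem_map_edgeHom hy hy'
    refine ⟨v * w, ?_⟩
    rw [SetLike.mem_coe, MonoidHom.mem_ker] at hv hw
    rw [MonoidHom.prod_apply, map_mul, map_mul, hv, hw, mul_one, one_mul]
  rintro ⟨hx, hy, hs⟩
  rcases Int.units_eq_one_or (Equiv.Perm.sign x.1.right) with h | h
  · exact even x hx hy h (hs ▸ h)
  -- A quarter turn changes both signs.
  · rw [← Subgroup.mul_mem_cancel_right _ (⟨FreeGroup.of (0, true), rfl⟩ :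
      cornerHom.prod edgeHom (FreeGroup.of (0, true)) ∈ (cornerHom.prod edgeHom).range)]
    refine even _ ?_ ?_ ?_ ?_
    · rw [Prod.fst_mul, map_mul, hx, MonoidHom.prod_apply, totalTwist_cornerHom, one_mul]
    · rw [Prod.snd_mul, map_mul, hy, MonoidHom.prod_apply, totalTwist_edgeHom, one_mul]
    · rw [Prod.fst_mul, SemidirectProduct.mul_right, map_mul, h, MonoidHom.prod_apply,
        sign_cornerHom_of]
      decide
    · rw [Prod.snd_mul, SemidirectProduct.mul_right, map_mul, ← hs, h, MonoidHom.prod_apply,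
        sign_edgeHom_of]
      decide

theorem Wreath.natCard (A B : Type) [CommGroup A] [Finite B] :
    Nat.card (Wreath A B) = Nat.card A ^ Nat.card B * (Nat.card B).factorial := by
  rw [SemidirectProduct.card, Nat.card_fun, Nat.card_perm]

theorem Wreath.exists_totalTwist_eq {A B : Type} [CommGroup A] [Fintype B] [DecidableEq B]
    [Nontrivial B] (a : A) (ε : ℤˣ) :
    ∃ w : Wreath A B, totalTwist A B w = a ∧ Equiv.Perm.sign w.right = ε := by
  obtain ⟨b, c, hbc⟩ := exists_pair_ne B
  rcases Int.units_eq_one_or ε with rfl | rfl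
  · exact ⟨⟨Pi.mulSingle b a, 1⟩, by simp [totalTwist_apply], map_one _⟩
  · exact ⟨⟨Pi.mulSingle b a, Equiv.swap b c⟩, by simp [totalTwist_apply], by simp [hbc]⟩

/-- The order of the group of the `2 × 2 × 2` cube, whose rotations in space are counted. -/
theorem natCard_range_cornerHom : Nat.card cornerHom.range = Nat.factorial 8 * 3 ^ 7 := by
  have h : cornerHom.range = (totalTwist C3 Corner).ker := by
    ext x
    exact mem_range_cornerHom_iff x
  have hs : (totalTwist C3 Corner).range = ⊤ :=
    MonoidHom.range_eq_top.2 fun a => by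
      obtain ⟨w, hw, -⟩ := Wreath.exists_totalTwist_eq (B := Corner) a 1
      exact ⟨w, hw⟩
  have := Subgroup.card_mul_index (totalTwist C3 Corner).ker
  rw [Subgroup.index_ker, hs, Subgroup.card_top, Wreath.natCard] at this
  rw [h]
  simp at this
  norm_num [Nat.factorial] at this ⊢
  omega

/-- The order of the group of the `3 × 3 × 3` cube. -/
theorem natCard_range_prod : Nat.card (cornerHom.prod edgeHom).range * 2 =
    Nat.factorial 8 * 3 ^ 7 * (Nat.factorial 12 * 2 ^ 11) := by
  -- The three laws of the cube are the kernel of a surjection onto a group of order `3 * 2 * 2`.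
  let χ : Wreath C3 Corner × Wreath C2 Edge →* (C3 × C2) × ℤˣ :=
    ((totalTwist C3 Corner).prodMap (totalTwist C2 Edge)).prod
      (((Equiv.Perm.sign.comp SemidirectProduct.rightHom).comp (MonoidHom.fst _ _)) *
        ((Equiv.Perm.sign.comp SemidirectProduct.rightHom).comp (MonoidHom.snd _ _)))
  have h : (cornerHom.prod edgeHom).range = χ.ker := by
    ext x
    rw [mem_range_prod_iff, MonoidHom.mem_ker, Prod.ext_iff, Prod.ext_iff, and_assoc]
    change _ ↔ _ ∧ _ ∧ Equiv.Perm.sign x.1.right * Equiv.Perm.sign x.2.right = 1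
    rw [mul_eq_one_iff_eq_inv, Int.units_inv_eq_self]
    rfl
  have hs : χ.range = ⊤ :=
    MonoidHom.range_eq_top.2 fun ⟨⟨a, b⟩, ε⟩ => by
      obtain ⟨v, hv, hv'⟩ := Wreath.exists_totalTwist_eq (B := Corner) a ε
      obtain ⟨w, hw, hw'⟩ := Wreath.exists_totalTwist_eq (B := Edge) b 1
      refine ⟨(v, w), Prod.ext (Prod.ext hv hw) ?_⟩
      change Equiv.Perm.sign v.right * Equiv.Perm.sign w.right = ε
      rw [hv', hw', mul_one]
  have := Subgroup.card_mul_index χ.ker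
  rw [Subgroup.index_ker, hs, Subgroup.card_top, Nat.card_prod (Wreath C3 Corner),
    Wreath.natCard, Wreath.natCard] at this
  rw [h]
  simp at this
  norm_num [Nat.factorial] at this ⊢
  omega

/-! ### Moves on single orbits of stickers -/

/-- The action of the moves on the orbit of stickers that lie at the depths `0`, `i`, `j` below the
three vectors of their frames. -/
def orbitHom (n i j : ℕ) : MoveGroup n →* Equiv.Perm Frame :=
  FreeGroup.lift fun m =>
    sliceAct (decide ((m.2 : ℕ) = 0)) (decide ((m.2 : ℕ) = i)) (decide ((m.2 : ℕ) = j)) m.1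

/-- The move with all turns of inner slices left out. -/
def outerPart (n : ℕ) : MoveGroup n →* FreeGroup Face :=
  FreeGroup.lift fun m => if (m.2 : ℕ) = 0 then FreeGroup.of m.1 else 1

/-- The action on an orbit of moves that turn slices at the depths named by `Fin m` only, where `0`
names depth zero. The orbit is given by the names `a`, `b` of its depths, `none` standing for a
depth without a name. So finitely many cases cover the cubes of all sizes. -/
def modelHom {m : ℕ} [NeZero m] (a b : Option (Fin m)) :
    FreeGroup (Face × Fin m) →* Equiv.Perm Frame :=
  FreeGroup.lift fun l =>
    sliceAct (decide (l.2 = 0)) (decide (a = some l.2)) (decide (b = some l.2)) l.1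

/-- The move with all turns of slices at named depths other than zero left out. -/
def modelOuterPart (m : ℕ) [NeZero m] : FreeGroup (Face × Fin m) →* FreeGroup Face :=
  FreeGroup.lift fun l => if l.2 = 0 then FreeGroup.of l.1 else 1

/-- Replace the names of depths by actual depths. -/
def insertDepths {n m : ℕ} (v : Fin m → Fin (n / 2)) : FreeGroup (Face × Fin m) →* MoveGroup n :=
  FreeGroup.map (Prod.map id v)

theorem exists_depthClass {n m : ℕ} {v : Fin m → Fin (n / 2)} (hv : Function.Injective v) (i : ℕ) :
    ∃ a : Option (Fin m), ∀ k, (v k : ℕ) = i ↔ a = some k := by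
  by_cases h : ∃ k, (v k : ℕ) = i
  · obtain ⟨k, rfl⟩ := h
    refine ⟨some k, fun l => ?_⟩
    rw [Option.some_inj, ← Fin.ext_iff, hv.eq_iff, eq_comm]
  · exact ⟨none, fun k => by simpa using fun hk => h ⟨k, hk⟩⟩

theorem orbitHom_insertDepths {n m : ℕ} [NeZero m] {v : Fin m → Fin (n / 2)}
    (hv : Function.Injective v) (hv₀ : (v 0 : ℕ) = 0) {i j : ℕ} {a b : Option (Fin m)}
    (ha : ∀ k, (v k : ℕ) = i ↔ a = some k) (hb : ∀ k, (v k : ℕ) = j ↔ b = some k)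
    (w : FreeGroup (Face × Fin m)) :
    orbitHom n i j (insertDepths v w) = modelHom a b w := by
  refine DFunLike.congr_fun (f := (orbitHom n i j).comp (insertDepths v)) (g := modelHom a b)
    (FreeGroup.ext_hom _ _ fun l => ?_) w
  have h₀ : (v l.2 : ℕ) = 0 ↔ l.2 = 0 := by rw [← hv₀, ← Fin.ext_iff, hv.eq_iff]
  simp [orbitHom, insertDepths, modelHom, h₀, ha, hb]

theorem outerPart_insertDepths {n m : ℕ} [NeZero m] {v : Fin m → Fin (n / 2)}
    (hv : Function.Injective v) (hv₀ : (v 0 : ℕ) = 0) (w : FreeGroup (Face × Fin m)) :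
    outerPart n (insertDepths v w) = modelOuterPart m w := by
  refine DFunLike.congr_fun (f := (outerPart n).comp (insertDepths v)) (g := modelOuterPart m)
    (FreeGroup.ext_hom _ _ fun l => ?_) w
  have h₀ : (v l.2 : ℕ) = 0 ↔ l.2 = 0 := by rw [← hv₀, ← Fin.ext_iff, hv.eq_iff]
  simp [outerPart, insertDepths, modelOuterPart, h₀]

/-- The product of a list of letters, each with the name of a depth. -/
def sliceWord {m : ℕ} (L : List ((Face × Bool) × Fin m)) : FreeGroup (Face × Fin m) :=
  FreeGroup.mk (L.map fun l => ((l.1.1, l.2), l.1.2))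

open scoped commutatorElement

open Letter in
/-- Cycles three stickers in the orbit of depths `(1, 0)` and fixes all other free orbits. -/
def wingCycle : FreeGroup (Face × Fin 2) :=
  ⁅sliceWord (m := 2) [(U', 0), (R, 0), (U, 0)], sliceWord (m := 2) [(L', 1)]⁆

open Letter in
/-- Cycles three stickers in the orbit of depths `(1, 1)` and fixes all other free orbits. -/
def diagonalCycle : FreeGroup (Face × Fin 2) :=
  ⁅sliceWord (m := 2) [(F', 0), (R, 1), (F, 0)], sliceWord (m := 2) [(L, 1)]⁆

open Letter in
/-- Cycles three stickers in the orbit of depths `(1, 2)` and fixes all other free orbits. -/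
def obliqueCycle : FreeGroup (Face × Fin 3) :=
  ⁅sliceWord (m := 3) [(F', 0), (L', 2), (F, 0)], sliceWord (m := 3) [(L', 1)]⁆

open Letter in
/-- Cycles three stickers in each orbit whose first depth is named `1` and whose second depth has no
name, and fixes the orbits without named depths. -/
def crossCycle : FreeGroup (Face × Fin 2) :=
  ⁅sliceWord (m := 2) [(U, 0), (R, 1), (U', 0)], sliceWord (m := 2) [(F, 1)]⁆

theorem modelOuterPart_commutator {m : ℕ} [NeZero m] (x : FreeGroup (Face × Fin m))
    (l : Face × Bool) {k : Fin m} (hk : k ≠ 0) : modelOuterPart m ⁅x, sliceWord [(l, k)]⁆ = 1 := by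
  have : modelOuterPart m (sliceWord [(l, k)]) = 1 := by
    cases h : l.2 <;> simp [modelOuterPart, FreeGroup.lift_mk, sliceWord, hk, h]
  rw [map_commutatorElement, this, commutatorElement_one_right]

theorem modelHom_wingCycle : ∀ a b : Option (Fin 2), a ≠ some 0 → ¬(a = some 1 ∧ b = some 0) →
    modelHom a b wingCycle = 1 := by
  decide +kernel

theorem modelHom_diagonalCycle : ∀ a b : Option (Fin 2), a ≠ some 0 →
    ¬(a = some 1 ∧ b = some 1) → modelHom a b diagonalCycle = 1 := by
  decide +kernel

theorem modelHom_obliqueCycle : ∀ a b : Option (Fin 3), a ≠ some 0 →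
    ¬(a = some 1 ∧ b = some 2) → modelHom a b obliqueCycle = 1 := by
  decide +kernel

theorem modelHom_crossCycle : modelHom none none crossCycle = 1 := by
  decide +kernel

theorem isThreeCycle_wingCycle : (modelHom (some 1) (some 0) wingCycle).IsThreeCycle := by
  rw [← card_support_eq_three_iff]
  decide +kernel

theorem isThreeCycle_diagonalCycle : (modelHom (some 1) (some 1) diagonalCycle).IsThreeCycle := by
  rw [← card_support_eq_three_iff]
  decide +kernel

theorem isThreeCycle_obliqueCycle : (modelHom (some 1) (some 2) obliqueCycle).IsThreeCycle := by
  rw [← card_support_eq_three_iff]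
  decide +kernel

theorem isThreeCycle_crossCycle : (modelHom (some 1) none crossCycle).IsThreeCycle := by
  rw [← card_support_eq_three_iff]
  decide +kernel

/-- A frame from which reachability is checked. -/
def frame₁ : Frame := ⟨((2, true), (0, true)), by decide⟩
/-- A frame from which reachability under the stabilizer of `frame₁` is checked. -/
def frame₂ : Frame := ⟨((2, false), (0, true)), by decide⟩

theorem mem_reach_sliceAct : ∀ (c d : Bool) (t : Frame), t ∈ reach
    (faces.map (sliceAct true false c) ++ faces.map (sliceAct false true d)) 8 frame₁ := by
  decide +kernel

theorem mem_reach_filter_sliceAct : ∀ (c d : Bool) (t : Frame), t ≠ frame₁ → t ∈ reach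
    ((faces.map (sliceAct true false c) ++ faces.map (sliceAct false true d)).filter
      fun s => s frame₁ = frame₁) 8 frame₂ := by
  decide +kernel

/-- The sign of a four-cycle that is present or not. -/
def signOf (b : Bool) : ℤˣ := if b then -1 else 1

/-- Each flag contributes one four-cycle. -/
theorem sign_sliceAct : ∀ (x y z : Bool) (f : Face),
    Equiv.Perm.sign (sliceAct x y z f) = signOf x * signOf y * signOf z := by
  decide +kernel

/-! ### Even permutations of single orbits -/

/-- The orbits on which the cube group induces all permutations, one for each kind of cubie other
than corners, middle edges and centres of faces. Those with second depth `0` consist of stickers of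
wings, the other ones of centre stickers. The second sticker of a wing, which lies in the orbit `(0,
i)`, moves along with the one in `(i, 0)`. -/
abbrev FreeOrbit (n : ℕ) : Type := {i : Fin (n / 2) // (i : ℕ) ≠ 0} × Fin ((n + 1) / 2)

/-- The action of the moves on all free orbits. -/
def freeOrbitsHom (n : ℕ) : MoveGroup n →* (FreeOrbit n → Equiv.Perm Frame) :=
  MonoidHom.mk' (fun w o => orbitHom n o.1.1 o.2 w) fun v w => funext fun _ => map_mul _ v w

theorem freeOrbitsHom_apply {n : ℕ} (w : MoveGroup n) (o : FreeOrbit n) :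
    freeOrbitsHom n w o = orbitHom n o.1.1 o.2 w := rfl

theorem isPreprimitive_of_sliceAct_mem {G : Subgroup (Equiv.Perm Frame)} (c d : Bool)
    (hc : ∀ f, sliceAct true false c f ∈ G) (hd : ∀ f, sliceAct false true d f ∈ G) :
    MulAction.IsPreprimitive G Frame := by
  refine isPreprimitive_of_reach _ (fun s hs => ?_) 8 frame₁ frame₂ (mem_reach_sliceAct c d)
    (mem_reach_filter_sliceAct c d)
  rw [List.mem_append, List.mem_map, List.mem_map] at hs
  rcases hs with ⟨f, -, rfl⟩ | ⟨f, -, rfl⟩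
  · exact hc f
  · exact hd f

theorem isPreprimitive_orbitHom {n : ℕ} (o : FreeOrbit n) :
    MulAction.IsPreprimitive (orbitHom n o.1.1 o.2).range Frame := by
  obtain ⟨⟨i, hi⟩, j⟩ := o
  refine isPreprimitive_of_sliceAct_mem (decide ((j : ℕ) = 0)) (decide ((i : ℕ) = j))
    (fun f => ⟨FreeGroup.of (f, ⟨0, by omega⟩), ?_⟩) (fun f => ⟨FreeGroup.of (f, i), ?_⟩)
  · simp [orbitHom, eq_comm (a := 0), hi]
  · simp [orbitHom, hi]

/-- The permutations of the orbit `o` that are induced by a move which fixes all other free orbits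
and becomes trivial when the turns of inner slices are left out. The second condition implies that
corners and middle edges are fixed, too. -/
def isolated {n : ℕ} (o : FreeOrbit n) : Subgroup (Equiv.Perm Frame) :=
  ((outerPart n).ker.map (freeOrbitsHom n)).comap
    (MonoidHom.mulSingle (fun _ : FreeOrbit n => Equiv.Perm Frame) o)

theorem mem_isolated {n : ℕ} {o : FreeOrbit n} {w : MoveGroup n} (h : outerPart n w = 1)
    (h' : ∀ o', o' ≠ o → freeOrbitsHom n w o' = 1) : freeOrbitsHom n w o ∈ isolated o := by
  refine ⟨w, h, funext fun o' => ?_⟩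
  rw [MonoidHom.mulSingle_apply]
  by_cases ho : o' = o
  · rw [ho, Pi.mulSingle_eq_same]
  · rw [Pi.mulSingle_eq_of_ne ho, h' o' ho]

theorem alternatingGroup_le_isolated_of_mem {n : ℕ} {o : FreeOrbit n} {σ : Equiv.Perm Frame}
    (hσ : σ ∈ isolated o) (h3 : σ.IsThreeCycle) : alternatingGroup Frame ≤ isolated o := by
  have hN : ∀ ρ ∈ isolated o, ∃ w, outerPart n w = 1 ∧ freeOrbitsHom n w = Pi.mulSingle o ρ := by
    rintro ρ ⟨w, hw, h⟩
    exact ⟨w, hw, h⟩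
  refine alternatingGroup_le_of_conj_mem ?_ (isPreprimitive_orbitHom o) ?_ ?_ h3 hσ
  · rw [Nat.card_eq_fintype_card]
    decide +kernel
  · intro ρ hρ
    obtain ⟨w, -, h⟩ := hN ρ hρ
    exact ⟨w, by rw [← freeOrbitsHom_apply, h, Pi.mulSingle_eq_same]⟩
  · rintro _ ⟨v, rfl⟩ ρ hρ
    obtain ⟨w, hw, h⟩ := hN ρ hρ
    have hvw := mem_isolated (o := o) (w := v * w * v⁻¹)
      (by rw [map_mul, map_mul, hw, mul_one, ← map_mul, mul_inv_cancel, map_one]) fun o' ho => by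
        rw [map_mul, map_mul, h, Pi.mul_apply, Pi.mul_apply, Pi.mulSingle_eq_of_ne ho, mul_one,
          map_inv, Pi.inv_apply, mul_inv_cancel]
    rwa [map_mul, map_mul, h, Pi.mul_apply, Pi.mul_apply, Pi.mulSingle_eq_same, map_inv,
      Pi.inv_apply] at hvw

theorem depthPair_injective {n : ℕ} [NeZero (n / 2)] {i : Fin (n / 2)} (hi : (i : ℕ) ≠ 0) :
    Function.Injective ![0, i] := by
  have : i ≠ 0 := fun h => hi (by rw [h]; rfl)
  intro a b
  fin_cases a <;> fin_cases b <;> simp [this, this.symm]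

theorem depthTriple_injective {n : ℕ} [NeZero (n / 2)] {i j : Fin (n / 2)} (hi : (i : ℕ) ≠ 0)
    (hj : (j : ℕ) ≠ 0) (hij : i ≠ j) : Function.Injective ![0, i, j] := by
  have hi : i ≠ 0 := fun h => hi (by rw [h]; rfl)
  have hj : j ≠ 0 := fun h => hj (by rw [h]; rfl)
  intro a b
  fin_cases a <;> fin_cases b <;> simp [hi, hi.symm, hj, hj.symm, hij, hij.symm]

theorem alternatingGroup_le_isolated_of_model {n m : ℕ} [NeZero m] {v : Fin m → Fin (n / 2)}
    (hv : Function.Injective v) (hv₀ : (v 0 : ℕ) = 0) {o : FreeOrbit n} {c d : Fin m}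
    (hc : (v c : ℕ) = o.1.1) (hd : (v d : ℕ) = o.2) {w : FreeGroup (Face × Fin m)}
    (hw : modelOuterPart m w = 1)
    (h : ∀ a b : Option (Fin m), a ≠ some 0 → ¬(a = some c ∧ b = some d) → modelHom a b w = 1)
    (h3 : (modelHom (some c) (some d) w).IsThreeCycle) :
    alternatingGroup Frame ≤ isolated o := by
  have cls : ∀ {i : ℕ} {e : Fin m}, (v e : ℕ) = i → ∀ k, (v k : ℕ) = i ↔ some e = some k := by
    rintro _ e rfl k
    rw [Option.some_inj, ← Fin.ext_iff, hv.eq_iff, eq_comm]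
  have key := mem_isolated (o := o) (w := insertDepths v w)
    (by rw [outerPart_insertDepths hv hv₀, hw]) fun o' ho => by
      obtain ⟨a, ha⟩ := exists_depthClass hv (o'.1.1 : ℕ)
      obtain ⟨b, hb⟩ := exists_depthClass hv (o'.2 : ℕ)
      rw [freeOrbitsHom_apply, orbitHom_insertDepths hv hv₀ ha hb]
      refine h a b ?_ ?_
      · rintro rfl
        exact o'.1.2 (((ha 0).2 rfl).symm.trans hv₀)
      · rintro ⟨rfl, rfl⟩
        refine ho (Prod.ext (Subtype.ext (Fin.ext ?_)) (Fin.ext ?_))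
        · exact ((ha c).2 rfl).symm.trans hc
        · exact ((hb d).2 rfl).symm.trans hd
  refine alternatingGroup_le_isolated_of_mem key ?_
  rwa [freeOrbitsHom_apply, orbitHom_insertDepths hv hv₀ (cls hc) (cls hd)]

/-- The case in which both depths are depths of slices that can be turned. -/
theorem alternatingGroup_le_isolated_of_lt {n : ℕ} {o : FreeOrbit n} (h : (o.2 : ℕ) < n / 2) :
    alternatingGroup Frame ≤ isolated o := by
  have : NeZero (n / 2) := ⟨by omega⟩
  have hi := o.1.2
  by_cases h0 : (o.2 : ℕ) = 0
  · exact alternatingGroup_le_isolated_of_model (depthPair_injective hi) rfl (c := 1) (d := 0) rfl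
      h0.symm (modelOuterPart_commutator _ _ (by decide)) modelHom_wingCycle isThreeCycle_wingCycle
  by_cases hd : (o.1.1 : ℕ) = o.2
  · exact alternatingGroup_le_isolated_of_model (depthPair_injective hi) rfl (c := 1) (d := 1) rfl
      hd (modelOuterPart_commutator _ _ (by decide)) modelHom_diagonalCycle
      isThreeCycle_diagonalCycle
  · exact alternatingGroup_le_isolated_of_model
      (depthTriple_injective hi (j := ⟨o.2, h⟩) h0 fun e => hd (congrArg Fin.val e)) rfl
      (c := 1) (d := 2) rfl rfl (modelOuterPart_commutator _ _ (by decide)) modelHom_obliqueCycle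
      isThreeCycle_obliqueCycle

/-- If the second depth is that of the middle slice, no turn moves that slice alone. The move
`crossCycle` then also acts on the orbits with the same first depth and another second depth, and on
some others that do not touch the middle slice; all of these effects are even and can be undone. -/
theorem alternatingGroup_le_isolated {n : ℕ} (o : FreeOrbit n) :
    alternatingGroup Frame ≤ isolated o := by
  by_cases h : (o.2 : ℕ) < n / 2
  · exact alternatingGroup_le_isolated_of_lt h
  have hi := o.1.2
  have : NeZero (n / 2) := ⟨by have := o.1.1.2; omega⟩
  have hv := depthPair_injective hi
  have hv₀ : ((![0, o.1.1] : Fin 2 → Fin (n / 2)) 0 : ℕ) = 0 := rfl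
  have hj : ∀ o' : FreeOrbit n, ¬(o'.2 : ℕ) < n / 2 →
      ∀ k, ((![0, o.1.1] : Fin 2 → Fin (n / 2)) k : ℕ) = o'.2 ↔ none = some k := fun o' h' k => by
    have := (![0, o.1.1] k).2
    simp only [reduceCtorEq, iff_false]
    omega
  set w : MoveGroup n := insertDepths ![0, o.1.1] crossCycle with hw
  have hwo : outerPart n w = 1 := by
    rw [outerPart_insertDepths hv hv₀]
    exact modelOuterPart_commutator _ _ (by decide)
  have even : ∀ o', freeOrbitsHom n w o' ∈ alternatingGroup Frame := fun o' => by
    rw [freeOrbitsHom_apply, Equiv.Perm.mem_alternatingGroup, hw, crossCycle,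
      map_commutatorElement, map_commutatorElement, map_commutatorElement,
      commutatorElement_eq_one_iff_mul_comm, mul_comm]
  -- Another orbit that touches the middle slice has another first depth, so none of its depths is
  -- named.
  have other : ∀ o', o' ≠ o → ¬(o'.2 : ℕ) < n / 2 → freeOrbitsHom n w o' = 1 := by
    intro o' ho h'
    obtain ⟨a, ha⟩ := exists_depthClass hv (o'.1.1 : ℕ)
    rw [freeOrbitsHom_apply, orbitHom_insertDepths hv hv₀ ha (hj o' h')]
    have e0 : a ≠ some 0 := by
      rintro rfl
      exact o'.1.2 (((ha 0).2 rfl).symm.trans hv₀)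
    have e1 : a ≠ some 1 := by
      rintro rfl
      refine ho (Prod.ext (Subtype.ext (Fin.ext ((ha 1).2 rfl).symm)) (Fin.ext ?_))
      have := o.2.2
      have := o'.2.2
      omega
    have : ∀ a : Option (Fin 2), a ≠ some 0 → a ≠ some 1 → a = none := by decide
    rw [this a e0 e1, modelHom_crossCycle]
  -- The effect on all orbits other than `o` is that of another move.
  have hc : Function.update (freeOrbitsHom n w) o 1 ∈
      (outerPart n).ker.map (freeOrbitsHom n) := by
    refine Subgroup.pi_mem_of_mulSingle_mem _ fun o' => ?_
    by_cases ho : o' = o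
    · rw [ho, Function.update_self, Pi.mulSingle_one]
      exact one_mem _
    rw [Function.update_of_ne ho]
    by_cases h' : (o'.2 : ℕ) < n / 2
    · exact Subgroup.mem_comap.1 (alternatingGroup_le_isolated_of_lt h' (even o'))
    · rw [other o' ho h', Pi.mulSingle_one]
      exact one_mem _
  obtain ⟨v, hv', hvw⟩ := hc
  have key := mem_isolated (o := o) (w := w * v⁻¹)
    (by rw [map_mul, map_inv, hwo, (MonoidHom.mem_ker).1 hv', inv_one, mul_one]) fun o' ho => by
      rw [map_mul, map_inv, hvw, Pi.mul_apply, Pi.inv_apply, Function.update_of_ne ho,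
        mul_inv_cancel]
  rw [map_mul, map_inv, hvw, Pi.mul_apply, Pi.inv_apply, Function.update_self, inv_one,
    mul_one] at key
  refine alternatingGroup_le_isolated_of_mem key ?_
  rw [freeOrbitsHom_apply, orbitHom_insertDepths hv hv₀ (a := some 1) ?_ (hj o h)]
  · exact isThreeCycle_crossCycle
  · intro k
    rw [Option.some_inj, eq_comm (a := (1 : Fin 2)), ← hv.eq_iff, Fin.ext_iff]
    rfl

/-- Even permutations can be prescribed on all free orbits at once. -/
theorem exists_freeOrbitsHom_eq {n : ℕ} (x : FreeOrbit n → Equiv.Perm Frame)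
    (hx : ∀ o, x o ∈ alternatingGroup Frame) :
    ∃ w, outerPart n w = 1 ∧ freeOrbitsHom n w = x := by
  obtain ⟨w, hw, h⟩ : x ∈ (outerPart n).ker.map (freeOrbitsHom n) :=
    Subgroup.pi_mem_of_mulSingle_mem _ fun o =>
      Subgroup.mem_comap.1 (alternatingGroup_le_isolated o (hx o))
  exact ⟨w, hw, h⟩

/-! ### Signs and the order of the image -/

/-- The parity of the number of turns of slices at depth `k`. -/
def depthSign (n k : ℕ) : MoveGroup n →* ℤˣ :=
  FreeGroup.lift fun m => signOf (decide ((m.2 : ℕ) = k))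

/-- The parity of the number of turns. -/
def turnParity : FreeGroup Face →* ℤˣ := FreeGroup.lift fun _ => -1

theorem sign_orbitHom {n : ℕ} (i j : ℕ) (w : MoveGroup n) :
    Equiv.Perm.sign (orbitHom n i j w) = depthSign n 0 w * depthSign n i w * depthSign n j w := by
  refine DFunLike.congr_fun (f := Equiv.Perm.sign.comp (orbitHom n i j))
    (g := depthSign n 0 * depthSign n i * depthSign n j) (FreeGroup.ext_hom _ _ fun m => ?_) w
  simp [orbitHom, depthSign, sign_sliceAct]

theorem depthSign_zero {n : ℕ} (w : MoveGroup n) :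
    depthSign n 0 w = turnParity (outerPart n w) := by
  refine DFunLike.congr_fun (f := depthSign n 0) (g := turnParity.comp (outerPart n))
    (FreeGroup.ext_hom _ _ fun m => ?_) w
  by_cases h : (m.2 : ℕ) = 0 <;> simp [depthSign, turnParity, outerPart, signOf, h]

theorem depthSign_of_le {n k : ℕ} (hk : n / 2 ≤ k) (w : MoveGroup n) : depthSign n k w = 1 := by
  refine DFunLike.congr_fun (f := depthSign n k) (g := 1) (FreeGroup.ext_hom _ _ fun m => ?_) w
  have : (m.2 : ℕ) ≠ k := by omega
  simp [depthSign, signOf, this]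

/-- The parities of the numbers of turns at each depth other than zero. -/
def innerSigns (n : ℕ) : MoveGroup n →* ({i : Fin (n / 2) // (i : ℕ) ≠ 0} → ℤˣ) :=
  MonoidHom.mk' (fun w i => depthSign n i.1 w) fun v w => funext fun _ => map_mul _ v w

theorem innerSigns_apply {n : ℕ} (w : MoveGroup n) (i : {i : Fin (n / 2) // (i : ℕ) ≠ 0}) :
    innerSigns n w i = depthSign n i.1 w := rfl

/-- A turn of an inner slice is a four-cycle of wings, and a face turn is two of them. -/
theorem innerSigns_eq_sign {n : ℕ} (w : MoveGroup n) (i : {i : Fin (n / 2) // (i : ℕ) ≠ 0}) :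
    innerSigns n w i =
      Equiv.Perm.sign (freeOrbitsHom n w (i, ⟨0, by have := i.1.2; omega⟩)) := by
  rw [freeOrbitsHom_apply, sign_orbitHom, mul_right_comm, Int.units_mul_self, one_mul,
    innerSigns_apply]

theorem outerPart_prod_innerSigns_surjective {n : ℕ} (hn : 2 ≤ n) :
    Function.Surjective ((outerPart n).prod (innerSigns n)) := by
  have h₁ : ∀ u : FreeGroup Face, ∃ w, outerPart n w = u ∧ innerSigns n w = 1 := fun u => by
    let e : FreeGroup Face →* MoveGroup n := FreeGroup.map fun f => (f, ⟨0, by omega⟩)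
    refine ⟨e u, ?_, ?_⟩
    · refine DFunLike.congr_fun (f := (outerPart n).comp e) (g := MonoidHom.id _)
        (FreeGroup.ext_hom _ _ fun f => ?_) u
      simp [outerPart, e]
    · refine DFunLike.congr_fun (f := (innerSigns n).comp e) (g := 1)
        (FreeGroup.ext_hom _ _ fun f => funext fun i => ?_) u
      have hi := Ne.symm i.2
      simp [innerSigns_apply, depthSign, e, signOf, hi]
  have h₂ : ∀ y, y ∈ (outerPart n).ker.map (innerSigns n) := fun y => by
    refine Subgroup.pi_mem_of_mulSingle_mem _ fun i => ?_
    rcases Int.units_eq_one_or (y i) with h | h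
    · rw [h, Pi.mulSingle_one]
      exact one_mem _
    -- One turn at depth `i` changes a single inner sign.
    · refine ⟨FreeGroup.of ((0, true), i.1), ?_, funext fun k => ?_⟩
      · simp [outerPart, i.2]
      · by_cases hk : k = i
        · subst hk
          simp [innerSigns_apply, depthSign, signOf, h]
        · have : (i.1 : ℕ) ≠ k.1 := fun e => hk (Subtype.ext (Fin.ext e.symm))
          simp [innerSigns_apply, depthSign, signOf, hk, this]
  rintro ⟨u, y⟩
  obtain ⟨w, hw, hw'⟩ := h₁ u
  obtain ⟨v, hv, rfl⟩ := h₂ y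
  refine ⟨w * v, ?_⟩
  rw [MonoidHom.prod_apply, map_mul, map_mul, hw, hw', MonoidHom.mem_ker.1 hv, mul_one, one_mul]

/-- The order of the image of the moves in the product of a group `A`, on which only the turns at
depth zero act, and the symmetric groups of the free orbits. The kernel of the map to `A` and to the
parities of inner turns induces exactly the even permutations on the free orbits, and the image of
that map is a full product. -/
theorem natCard_range_prod_freeOrbitsHom {n : ℕ} (hn : 2 ≤ n) {A : Type} [Group A]
    (ψ : FreeGroup Face →* A) (hψ : ∀ u, ψ u = 1 → turnParity u = 1) :
    Nat.card ((ψ.comp (outerPart n)).prod (freeOrbitsHom n)).range *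
        2 ^ ((n / 2 - 1) * ((n + 1) / 2)) =
      Nat.card ψ.range * 2 ^ (n / 2 - 1) *
        Nat.factorial 24 ^ ((n / 2 - 1) * ((n + 1) / 2)) := by
  set Φ := (ψ.comp (outerPart n)).prod (freeOrbitsHom n) with hΦ
  set Ψ := (ψ.comp (outerPart n)).prod (innerSigns n) with hΨ
  have hI : Nat.card {i : Fin (n / 2) // (i : ℕ) ≠ 0} = n / 2 - 1 := by
    have : NeZero (n / 2) := ⟨by omega⟩
    have h : ∀ i : Fin (n / 2), (i : ℕ) ≠ 0 ↔ i ≠ 0 := fun i => by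
      rw [Ne, Ne, Fin.ext_iff]
      rfl
    rw [Nat.card_congr (Equiv.subtypeEquivRight h), Nat.card_eq_fintype_card,
      Fintype.card_subtype_compl, Fintype.card_fin, Fintype.card_subtype_eq]
  have hO : Nat.card (FreeOrbit n) = (n / 2 - 1) * ((n + 1) / 2) := by
    rw [Nat.card_prod, hI, Nat.card_fin]
  have even : ∀ w ∈ Ψ.ker, ∀ o, freeOrbitsHom n w o ∈ alternatingGroup Frame := by
    intro w hw o
    rw [MonoidHom.mem_ker, hΨ, MonoidHom.prod_apply, Prod.mk_eq_one] at hw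
    have h0 : depthSign n 0 w = 1 := by rw [depthSign_zero, hψ _ hw.1]
    have hi : ∀ i, depthSign n i w = 1 := fun i => by
      by_cases h : n / 2 ≤ i
      · exact depthSign_of_le h w
      by_cases h' : i = 0
      · rw [h', h0]
      · exact congrFun hw.2 ⟨⟨i, not_le.1 h⟩, h'⟩
    rw [Equiv.Perm.mem_alternatingGroup, freeOrbitsHom_apply, sign_orbitHom, hi, hi, hi, mul_one,
      mul_one]
  -- The index of `Φ.ker` is the product of its index in `Ψ.ker` and the index of `Ψ.ker`.
  let δ : Ψ.ker →* (FreeOrbit n → alternatingGroup Frame) :=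
    MonoidHom.mk' (fun w o => ⟨freeOrbitsHom n w o, even w w.2 o⟩) fun v w => funext fun o =>
      Subtype.ext (congrFun (map_mul (freeOrbitsHom n) v.1 w.1) o)
  have hδ : δ.ker = Φ.ker.subgroupOf Ψ.ker := by
    ext w
    have hw := (Prod.mk_eq_one.1 (MonoidHom.mem_ker.1 w.2))
    rw [MonoidHom.mem_ker, Subgroup.mem_subgroupOf, MonoidHom.mem_ker, hΦ, MonoidHom.prod_apply,
      Prod.mk_eq_one, and_iff_right hw.1, funext_iff, funext_iff]
    exact forall_congr' fun o => Subtype.ext_iff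
  have hδs : δ.range = ⊤ := MonoidHom.range_eq_top.2 fun x => by
    obtain ⟨w, hw, h⟩ := exists_freeOrbitsHom_eq (fun o => (x o).1) fun o => (x o).2
    refine ⟨⟨w, ?_⟩, funext fun o => Subtype.ext (congrFun h o)⟩
    rw [MonoidHom.mem_ker, hΨ, MonoidHom.prod_apply, Prod.mk_eq_one, MonoidHom.comp_apply, hw,
      map_one]
    refine ⟨rfl, funext fun i => ?_⟩
    rw [innerSigns_eq_sign, h]
    exact (x _).2
  have hker : Φ.ker ≤ Ψ.ker := by
    intro w hw
    rw [MonoidHom.mem_ker, hΦ, MonoidHom.prod_apply, Prod.mk_eq_one] at hw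
    rw [MonoidHom.mem_ker, hΨ, MonoidHom.prod_apply, Prod.mk_eq_one]
    refine ⟨hw.1, funext fun i => ?_⟩
    rw [innerSigns_eq_sign, hw.2, Pi.one_apply, map_one, Pi.one_apply]
  have hΨr : Nat.card Ψ.range = Nat.card ψ.range * 2 ^ (n / 2 - 1) := by
    have : Ψ.range = ψ.range.prod ⊤ := by
      ext ⟨a, y⟩
      rw [Subgroup.mem_prod]
      constructor
      · rintro ⟨w, h⟩
        rw [hΨ, MonoidHom.prod_apply, Prod.mk.injEq] at h
        exact ⟨⟨_, h.1⟩, Subgroup.mem_top _⟩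
      · rintro ⟨⟨u, rfl⟩, -⟩
        obtain ⟨w, hw⟩ := outerPart_prod_innerSigns_surjective hn (u, y)
        rw [MonoidHom.prod_apply, Prod.mk.injEq] at hw
        refine ⟨w, ?_⟩
        rw [hΨ, MonoidHom.prod_apply, MonoidHom.comp_apply, hw.1, hw.2]
    rw [this, Nat.card_congr (Subgroup.prodEquiv _ _).toEquiv, Nat.card_prod, Subgroup.card_top,
      Nat.card_fun, hI]
    simp
  have hcard := Subgroup.relIndex_mul_index hker
  rw [Subgroup.relIndex, ← hδ, Subgroup.index_ker, Subgroup.index_ker, Subgroup.index_ker, hδs,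
    Subgroup.card_top, Nat.card_fun, hO, hΨr] at hcard
  have hA : 2 * Nat.card (alternatingGroup Frame) = Nat.factorial 24 := by
    have : Nontrivial Frame := ⟨frame₁, frame₂, by decide⟩
    rw [two_mul_nat_card_alternatingGroup, Nat.card_perm]
    congr 1
    rw [Nat.card_eq_fintype_card]
    decide +kernel
  rw [← hcard, ← hA, mul_pow]
  ring

/-! ### Stickers as frames with depths -/

/-- The coordinate, along the axis of `f`, of the slice at depth `k` below the face `f`. -/
def level {n : ℕ} (f : Face) (k : Fin n) : Fin n := if f.2 = true then k.rev else k

theorem level_eq_level_iff {n : ℕ} {f g : Face} (h : f.1 = g.1) {k l : Fin n} (hk : (k : ℕ) < n / 2)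
    (hl : 2 * (l : ℕ) < n) : level f k = level g l ↔ f = g ∧ k = l := by
  obtain ⟨a, b⟩ := f
  obtain ⟨a', b'⟩ := g
  obtain rfl : a = a' := h
  cases b <;> cases b' <;> simp [level, Fin.ext_iff, Fin.val_rev] <;> omega

theorem level_congr_of_middle {n : ℕ} (f g : Face) {k : Fin n} (hk : 2 * (k : ℕ) + 1 = n) :
    level f k = level g k := by
  have : k.rev = k := Fin.ext (by rw [Fin.val_rev]; omega)
  simp [level, this]

theorem exists_eq_level {n : ℕ} (a : Fin 3) (x : Fin n) :
    ∃ f : Face, f.1 = a ∧ ∃ k : Fin n, 2 * (k : ℕ) < n ∧ x = level f k := by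
  by_cases h : 2 * (x : ℕ) < n
  · exact ⟨(a, false), rfl, x, h, rfl⟩
  · refine ⟨(a, true), rfl, x.rev, ?_, by simp [level]⟩
    rw [Fin.val_rev]
    omega

namespace Frame

theorem axes_ne : ∀ t : Frame,
    t.fst.1 ≠ t.snd.1 ∧ t.fst.1 ≠ t.thd.1 ∧ t.snd.1 ≠ t.thd.1 := by decide +kernel

theorem axis_cases : ∀ (t : Frame) (a : Fin 3), a = t.fst.1 ∨ a = t.snd.1 ∨ a = t.thd.1 := by
  decide +kernel

theorem thd_frameTurn : ∀ (f : Face) (t : Frame), (frameTurn f t).thd = faceTurn f t.thd := by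
  decide +kernel

theorem ext_fst_snd {t t' : Frame} (h₁ : t.fst = t'.fst) (h₂ : t.snd = t'.snd) : t = t' :=
  Subtype.ext (Prod.ext h₁ h₂)

theorem not_swapped : ∀ t t' : Frame, t.fst = t'.fst → t.snd = t'.thd → t.thd ≠ t'.snd := by
  decide +kernel

theorem exists_fst_eq : ∀ (e : Face), ∃ t : Frame, t.fst = e := by decide +kernel

/-- Two orthogonal vectors `g`, `h` form a right-handed frame with a third one in one of their two
orders. -/
theorem exists_reorient : ∀ (t : Frame) (g h : Face), g.1 = t.snd.1 → h.1 = t.thd.1 →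
    ∃ t' : Frame, t'.fst = t.fst ∧ (t'.snd = g ∧ t'.thd = h ∨ t'.snd = h ∧ t'.thd = g) := by
  decide +kernel

theorem exists_quarter : ∀ t : Frame, ∃ t' : Frame, t'.fst = t.fst ∧ t'.snd = t.thd ∧
    t'.thd.1 = t.snd.1 := by
  decide +kernel

end Frame

/-- The sticker on the face `t.fst` that lies at depth `i` below `t.snd` and at depth `j` below
`t.thd`. -/
def stickerAt {n : ℕ} [NeZero n] (i j : Fin n) (t : Frame) : Sticker n :=
  ⟨(fun a => if a = t.fst.1 then level t.fst 0 else if a = t.snd.1 then level t.snd i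
    else level t.thd j, t.fst), by
    have := NeZero.pos n
    cases h : t.fst.2 <;> simp [IsOuter, level, h, Fin.val_rev]
    omega⟩

theorem stickerAt_face {n : ℕ} [NeZero n] (i j : Fin n) (t : Frame) :
    (stickerAt i j t).face = t.fst := rfl

theorem stickerAt_fst {n : ℕ} [NeZero n] (i j : Fin n) (t : Frame) :
    (stickerAt i j t).cubie t.fst.1 = level t.fst 0 := if_pos rfl

theorem stickerAt_snd {n : ℕ} [NeZero n] (i j : Fin n) (t : Frame) :
    (stickerAt i j t).cubie t.snd.1 = level t.snd i :=
  (if_neg t.axes_ne.1.symm).trans (if_pos rfl)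

theorem stickerAt_thd {n : ℕ} [NeZero n] (i j : Fin n) (t : Frame) :
    (stickerAt i j t).cubie t.thd.1 = level t.thd j :=
  (if_neg t.axes_ne.2.1.symm).trans (if_neg t.axes_ne.2.2.symm)

theorem Sticker.cubie_face {n : ℕ} [NeZero n] (s : Sticker n) :
    s.cubie s.face.1 = level s.face 0 := by
  obtain ⟨⟨p, a, b⟩, h⟩ := s
  have := NeZero.pos n
  cases b
  · exact Fin.ext h
  · replace h : (p a : ℕ) + 1 = n := h
    change p a = Fin.rev 0
    rw [Fin.ext_iff, Fin.val_rev, Fin.val_zero]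
    omega

theorem eq_stickerAt {n : ℕ} [NeZero n] {i j : Fin n} {t : Frame} {s : Sticker n}
    (h₁ : s.face = t.fst) (h₂ : s.cubie t.snd.1 = level t.snd i)
    (h₃ : s.cubie t.thd.1 = level t.thd j) : s = stickerAt i j t := by
  refine Subtype.ext (Prod.ext (funext fun a => ?_) h₁)
  change s.cubie a = (stickerAt i j t).cubie a
  rcases t.axis_cases a with rfl | rfl | rfl
  · rw [stickerAt_fst, ← h₁, s.cubie_face]
  · rw [h₂, stickerAt_snd]
  · rw [h₃, stickerAt_thd]

theorem stickerAt_injective {n : ℕ} [NeZero n] {i j : Fin n} (hi : (i : ℕ) < n / 2)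
    (hj : 2 * (j : ℕ) < n) : Function.Injective (stickerAt i j) := by
  intro t t' h
  have h₁ : t.fst = t'.fst := congrArg Sticker.face h
  rcases t'.axis_cases t.snd.1 with ha | ha | ha
  · exact absurd (ha.trans (congrArg Prod.fst h₁).symm) t.axes_ne.1.symm
  · have h₂ := stickerAt_snd i j t
    rw [h, ha, stickerAt_snd, level_eq_level_iff ha.symm hi (by omega)] at h₂
    exact Frame.ext_fst_snd h₁ h₂.1.symm
  -- If the last two axes were exchanged, so would be the last two vectors, against orientation.
  · have h₂ := stickerAt_snd i j t
    rw [h, ha, stickerAt_thd, eq_comm, level_eq_level_iff ha hi hj] at h₂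
    have hb : t'.snd.1 = t.thd.1 := by
      rcases t.axis_cases t'.snd.1 with hb | hb | hb
      · exact absurd (hb.trans (congrArg Prod.fst h₁)) t'.axes_ne.1.symm
      · exact absurd (hb.trans ha) t'.axes_ne.2.2
      · exact hb
    have h₃ := stickerAt_snd i j t'
    rw [← h, hb, stickerAt_thd, eq_comm, level_eq_level_iff hb hi hj] at h₃
    exact absurd h₃.1.symm (t.not_swapped t' h₁ h₂.1)

theorem meets_iff {n : ℕ} [NeZero n] {i j k : Fin n} (hi : 2 * (i : ℕ) < n) (hj : 2 * (j : ℕ) < n)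
    (hk : (k : ℕ) < n / 2) (f : Face) (t : Frame) :
    (stickerAt i j t).cubie f.1 = level f k ↔
      meets (decide ((k : ℕ) = 0)) (decide ((k : ℕ) = i)) (decide ((k : ℕ) = j)) f t = true := by
  have hn := NeZero.pos n
  have h0 : 2 * ((0 : Fin n) : ℕ) < n := by simpa using hn
  obtain ⟨h₁, h₂, h₃⟩ := t.axes_ne
  have ne : ∀ {a b : Face}, a.1 ≠ b.1 → a ≠ b := fun h e => h (congrArg Prod.fst e)
  have k0 : k = 0 ↔ (k : ℕ) = 0 := by rw [Fin.ext_iff]; rfl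
  rw [meets]
  simp only [Bool.or_eq_true, Bool.and_eq_true, decide_eq_true_iff]
  -- The face `f` is compared with the vector of the frame on the same axis.
  rcases t.axis_cases f.1 with ha | ha | ha
  · have e₂ : t.snd ≠ f := ne (ha ▸ h₁.symm)
    have e₃ : t.thd ≠ f := ne (ha ▸ h₂.symm)
    rw [ha, stickerAt_fst, eq_comm, level_eq_level_iff ha hk h0, k0]
    tauto
  · have e₁ : t.fst ≠ f := ne (ha ▸ h₁)
    have e₃ : t.thd ≠ f := ne (ha ▸ h₃.symm)
    rw [ha, stickerAt_snd, eq_comm, level_eq_level_iff ha hk hi, Fin.ext_iff]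
    tauto
  · have e₁ : t.fst ≠ f := ne (ha ▸ h₂)
    have e₂ : t.snd ≠ f := ne (ha ▸ h₃)
    rw [ha, stickerAt_thd, eq_comm, level_eq_level_iff ha hk hj, Fin.ext_iff]
    tauto

/-- The clockwise quarter turn of the whole cube about `f` on stickers. -/
def stickerTurn (n : ℕ) (f : Face) : Equiv.Perm (Sticker n) :=
  if f.2 = true then (turnSticker n f.1)⁻¹ else turnSticker n f.1

theorem turnPosition_eq_level_iff {n : ℕ} (a : Fin 3) (g : Face) (p : Position n) (k : Fin n) :
    turnPosition n a p (turnFace a g).1 = level (turnFace a g) k ↔ p g.1 = level g k := by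
  obtain ⟨b, c⟩ := g
  fin_cases a <;> fin_cases b <;> cases c <;>
    simp [turnPosition, turnFace, level, Fin.rev_eq_iff]

theorem stickerTurn_face {n : ℕ} (f : Face) (s : Sticker n) :
    (stickerTurn n f s).face = faceTurn f s.face := by
  unfold stickerTurn faceTurn
  split_ifs
  · rfl
  · rfl

theorem stickerTurn_eq_level_iff {n : ℕ} (f g : Face) (s : Sticker n) (k : Fin n) :
    (stickerTurn n f s).cubie (faceTurn f g).1 = level (faceTurn f g) k ↔
      s.cubie g.1 = level g k := by
  unfold stickerTurn faceTurn
  split_ifs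
  · have := turnPosition_eq_level_iff f.1 ((turnFace f.1).symm g)
      ((turnPosition n f.1).symm s.cubie) k
    rw [Equiv.apply_symm_apply, Equiv.apply_symm_apply] at this
    exact this.symm
  · exact turnPosition_eq_level_iff f.1 g s.cubie k

theorem stickerTurn_stickerAt {n : ℕ} [NeZero n] (f : Face) (i j : Fin n) (t : Frame) :
    stickerTurn n f (stickerAt i j t) = stickerAt i j (frameTurn f t) := by
  refine eq_stickerAt ?_ ?_ ?_
  · rw [stickerTurn_face, stickerAt_face]
    rfl
  · exact (stickerTurn_eq_level_iff f t.snd _ i).2 (stickerAt_snd i j t)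
  · rw [Frame.thd_frameTurn]
    exact (stickerTurn_eq_level_iff f t.thd _ j).2 (stickerAt_thd i j t)

theorem SliceRotation.perm_apply {n : ℕ} (m : SliceRotation n) (s : Sticker n) :
    SliceRotation.perm m s =
      if s.cubie m.1.1 = level m.1 ⟨m.2, lt_of_lt_of_le m.2.2 (Nat.div_le_self n 2)⟩ then
        stickerTurn n m.1 s else s := by
  obtain ⟨⟨a, b⟩, k⟩ := m
  cases b
  · rfl
  · rfl

theorem sliceRotation_perm_stickerAt {n : ℕ} [NeZero n] {i j : Fin n} (hi : 2 * (i : ℕ) < n)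
    (hj : 2 * (j : ℕ) < n) (m : SliceRotation n) (t : Frame) :
    SliceRotation.perm m (stickerAt i j t) = stickerAt i j
      (sliceAct (decide ((m.2 : ℕ) = 0)) (decide ((m.2 : ℕ) = i)) (decide ((m.2 : ℕ) = j))
        m.1 t) := by
  rw [SliceRotation.perm_apply, stickerTurn_stickerAt]
  rw [if_congr (meets_iff hi hj (k := ⟨m.2, _⟩) m.2.2 m.1 t) rfl rfl]
  exact (apply_ite (stickerAt i j) _ _ _).symm

theorem stickerPerm_stickerAt {n : ℕ} [NeZero n] {i j : Fin n} (hi : 2 * (i : ℕ) < n)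
    (hj : 2 * (j : ℕ) < n) (w : MoveGroup n) (t : Frame) :
    stickerPerm n w (stickerAt i j t) = stickerAt i j (orbitHom n i j w t) := by
  induction w using FreeGroup.induction_on generalizing t with
  | C1 => simp
  | of m => simpa [stickerPerm, orbitHom] using sliceRotation_perm_stickerAt hi hj m t
  | inv_of m ih =>
    rw [map_inv, map_inv, Equiv.Perm.inv_eq_iff_eq, ih]
    congr 1
    exact ((orbitHom n i j _).apply_symm_apply t).symm
  | mul x y hx hy => rw [map_mul, map_mul, Equiv.Perm.mul_apply, Equiv.Perm.mul_apply, hy, hx]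

/-- Every sticker is given by a frame and two depths, the first of which is that of a slice that can
be turned unless the sticker is the central one of its face. -/
theorem exists_eq_stickerAt {n : ℕ} [NeZero n] (s : Sticker n) :
    ∃ (i j : Fin n) (t : Frame), s = stickerAt i j t ∧ 2 * (j : ℕ) < n ∧
      ((i : ℕ) < n / 2 ∨ 2 * (i : ℕ) + 1 = n ∧ 2 * (j : ℕ) + 1 = n) := by
  -- If the first depth is that of the middle slice, exchange the two depths by a quarter turn
  -- about the face of the sticker; the sign of the middle coordinate is immaterial.
  have fin : ∀ (t : Frame) (k l : Fin n), s.face = t.fst → s.cubie t.snd.1 = level t.snd k →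
      s.cubie t.thd.1 = level t.thd l → 2 * (k : ℕ) < n → 2 * (l : ℕ) < n →
      ∃ (i j : Fin n) (t : Frame), s = stickerAt i j t ∧ 2 * (j : ℕ) < n ∧
        ((i : ℕ) < n / 2 ∨ 2 * (i : ℕ) + 1 = n ∧ 2 * (j : ℕ) + 1 = n) := by
    intro t k l h₁ h₂ h₃ hk hl
    by_cases hk' : (k : ℕ) < n / 2
    · exact ⟨k, l, t, eq_stickerAt h₁ h₂ h₃, hl, Or.inl hk'⟩
    by_cases hl' : (l : ℕ) < n / 2
    · obtain ⟨t', e₁, e₂, e₃⟩ := t.exists_quarter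
      refine ⟨l, k, t', eq_stickerAt (h₁.trans e₁.symm) (e₂ ▸ h₃) ?_, hk, Or.inl hl'⟩
      rw [e₃, h₂]
      exact level_congr_of_middle _ _ (by omega)
    · exact ⟨k, l, t, eq_stickerAt h₁ h₂ h₃, hl, Or.inr ⟨by omega, by omega⟩⟩
  obtain ⟨t, ht⟩ := Frame.exists_fst_eq s.face
  obtain ⟨g, hg, k, hk, hgk⟩ := exists_eq_level t.snd.1 (s.cubie t.snd.1)
  obtain ⟨h, hh, l, hl, hhl⟩ := exists_eq_level t.thd.1 (s.cubie t.thd.1)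
  rw [← hg] at hgk
  rw [← hh] at hhl
  obtain ⟨t', h₁, ⟨rfl, rfl⟩ | ⟨rfl, rfl⟩⟩ := t.exists_reorient g h hg hh
  · exact fin t' k l (ht.symm.trans h₁.symm) hgk hhl hk hl
  · exact fin t' l k (ht.symm.trans h₁.symm) hhl hgk hl hk

theorem fst_sliceAct : ∀ (x : Bool) (f : Face) (t : Frame),
    (sliceAct x false false f t).fst = t.fst := by
  decide +kernel

theorem fst_orbitHom {n i j : ℕ} (hi : n / 2 ≤ i) (hj : n / 2 ≤ j) (w : MoveGroup n) (t : Frame) :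
    (orbitHom n i j w t).fst = t.fst := by
  induction w using FreeGroup.induction_on generalizing t with
  | C1 => simp
  | of m =>
    have h₁ : (m.2 : ℕ) ≠ i := by omega
    have h₂ : (m.2 : ℕ) ≠ j := by omega
    simp [orbitHom, h₁, h₂, fst_sliceAct]
  | inv_of m ih =>
    rw [map_inv, ← ih ((orbitHom n i j _)⁻¹ t)]
    exact congrArg Frame.fst ((orbitHom n i j _).apply_symm_apply t)
  | mul x y hx hy => rw [map_mul, Equiv.Perm.mul_apply, hx, hy]

theorem stickerAt_congr_of_middle {n : ℕ} [NeZero n] {i j : Fin n} (hi : 2 * (i : ℕ) + 1 = n)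
    (hj : 2 * (j : ℕ) + 1 = n) {t t' : Frame} (h : t.fst = t'.fst) :
    stickerAt i j t = stickerAt i j t' := by
  obtain rfl : i = j := Fin.ext (by omega)
  have mid : ∀ (t : Frame) (a : Fin 3), a ≠ t.fst.1 →
      (stickerAt i i t).cubie a = level t.snd i := fun t a ha => by
    rcases t.axis_cases a with rfl | rfl | rfl
    · exact absurd rfl ha
    · exact stickerAt_snd i i t
    · rw [stickerAt_thd]
      exact level_congr_of_middle _ _ hi
  refine eq_stickerAt h ?_ ?_
  · rw [mid t _ (h ▸ t'.axes_ne.1.symm)]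
    exact level_congr_of_middle _ _ hi
  · rw [mid t _ (h ▸ t'.axes_ne.2.1.symm)]
    exact level_congr_of_middle _ _ hi

/-- A move fixes all stickers if it fixes all orbits of stickers that are not central on their
face. -/
theorem stickerPerm_eq_one_iff {n : ℕ} [NeZero n] (w : MoveGroup n) :
    stickerPerm n w = 1 ↔ ∀ i j : ℕ, i < n / 2 → 2 * j < n → orbitHom n i j w = 1 := by
  constructor
  · intro h i j hi hj
    ext1 t
    have key := stickerPerm_stickerAt (i := ⟨i, by omega⟩) (j := ⟨j, by omega⟩)
      (show 2 * i < n by omega) hj w t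
    rw [h] at key
    exact (stickerAt_injective (i := ⟨i, by omega⟩) (j := ⟨j, by omega⟩) hi hj key).symm
  · intro h
    ext1 s
    obtain ⟨i, j, t, rfl, hj, hi | ⟨hi, hj'⟩⟩ := exists_eq_stickerAt s
    · rw [stickerPerm_stickerAt (by omega) hj, h i j hi hj]
      rfl
    · rw [stickerPerm_stickerAt (by omega) hj]
      exact stickerAt_congr_of_middle hi hj' (fst_orbitHom (by omega) (by omega) w t)

/-- The cyclic shift of the three vectors of a frame. On stickers of corners and wings it goes from
one sticker of a cubie to another. -/
def frameShift : Equiv.Perm Frame where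
  toFun t := ⟨(t.snd, t.thd), t.axes_ne.2.2⟩
  invFun t := ⟨(t.thd, t.fst), t.axes_ne.2.1.symm⟩
  left_inv := by decide +kernel
  right_inv := by decide +kernel

theorem sliceAct_shift : ∀ (x y : Bool) (f : Face),
    sliceAct x x y f = frameShift⁻¹ * sliceAct x y x f * frameShift := by
  decide +kernel

/-- The two stickers of a wing move together. -/
theorem orbitHom_zero_left {n : ℕ} (j : ℕ) (w : MoveGroup n) :
    orbitHom n 0 j w = frameShift⁻¹ * orbitHom n j 0 w * frameShift := by
  refine DFunLike.congr_fun (f := orbitHom n 0 j)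
    (g := (MulAut.conj frameShift⁻¹).toMonoidHom.comp (orbitHom n j 0))
    (FreeGroup.ext_hom _ _ fun m => ?_) w
  simpa [orbitHom] using sliceAct_shift _ _ _

theorem sliceAct_false : ∀ f, sliceAct false false false f = 1 := by decide +kernel

theorem orbitHom_zero_zero {n : ℕ} (w : MoveGroup n) :
    orbitHom n 0 0 w = FreeGroup.lift (sliceAct true true true) (outerPart n w) := by
  refine DFunLike.congr_fun (f := orbitHom n 0 0)
    (g := (FreeGroup.lift (sliceAct true true true)).comp (outerPart n))
    (FreeGroup.ext_hom _ _ fun m => ?_) w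
  by_cases h : (m.2 : ℕ) = 0
  · simp [orbitHom, outerPart, h]
  · simp [orbitHom, outerPart, h, sliceAct_false]

theorem orbitHom_zero_middle {n j : ℕ} (hj : n / 2 ≤ j) (w : MoveGroup n) :
    orbitHom n 0 j w = FreeGroup.lift (sliceAct true true false) (outerPart n w) := by
  refine DFunLike.congr_fun (f := orbitHom n 0 j)
    (g := (FreeGroup.lift (sliceAct true true false)).comp (outerPart n))
    (FreeGroup.ext_hom _ _ fun m => ?_) w
  have hm : (m.2 : ℕ) ≠ j := by omega
  by_cases h : (m.2 : ℕ) = 0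
  · have h0 : j ≠ 0 := fun e => hm (h.trans e.symm)
    simp [orbitHom, outerPart, h, h0.symm]
  · simp [orbitHom, outerPart, h, hm, sliceAct_false]

/-! ### The order of the cube group -/

theorem turnParity_eq_one_of_cornerHom_eq_one {u : FreeGroup Face} (hu : cornerHom u = 1) :
    turnParity u = 1 := by
  have h : Equiv.Perm.sign (cornerHom u).right = turnParity u := by
    refine DFunLike.congr_fun
      (f := (Equiv.Perm.sign.comp SemidirectProduct.rightHom).comp cornerHom)
      (g := turnParity) (FreeGroup.ext_hom _ _ fun f => ?_) u
    rw [turnParity, FreeGroup.lift_apply_of]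
    exact sign_cornerHom_of f
  rw [← h, hu, SemidirectProduct.one_right, map_one]

theorem stickerPerm_eq_one_iff_freeOrbitsHom {n : ℕ} (hn : 2 ≤ n) (w : MoveGroup n) :
    stickerPerm n w = 1 ↔ freeOrbitsHom n w = 1 ∧ cornerHom (outerPart n w) = 1 ∧
      (Odd n → edgeHom (outerPart n w) = 1) := by
  have : NeZero n := ⟨by omega⟩
  rw [stickerPerm_eq_one_iff, cornerHom_eq_one_iff, edgeHom_eq_one_iff, ← orbitHom_zero_zero,
    ← orbitHom_zero_middle le_rfl]
  constructor
  · intro h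
    refine ⟨funext fun o => h _ _ o.1.1.2 ?_, h 0 0 (by omega) (by omega), fun ho => ?_⟩
    · have := o.2.2
      omega
    · obtain ⟨m, rfl⟩ := ho
      exact h _ _ (by omega) (by omega)
  · rintro ⟨hf, hc, he⟩
    have free : ∀ i j : ℕ, i ≠ 0 → i < n / 2 → 2 * j < n → orbitHom n i j w = 1 :=
      fun i j h0 hi hj => congrFun hf (⟨⟨i, hi⟩, h0⟩, ⟨j, by omega⟩)
    intro i j hi hj
    by_cases h0 : i = 0
    · subst h0
      by_cases hj0 : j = 0
      · rw [hj0, hc]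
      by_cases hj' : j < n / 2
      · rw [orbitHom_zero_left, free j 0 hj0 hj' (by omega), mul_one, inv_mul_cancel]
      · obtain rfl : j = n / 2 := by omega
        exact he (Nat.odd_iff.2 (by omega))
    · exact free i j h0 hi hj

/-- The order of the cube group in terms of the action on corners and middle edges. -/
theorem natCard_cubeGroup_of_ker {n : ℕ} (hn : 2 ≤ n) {A : Type} [Group A]
    (ψ : FreeGroup Face →* A) (hψ : ∀ u, ψ u = 1 → turnParity u = 1)
    (h : ∀ w : MoveGroup n, stickerPerm n w = 1 ↔
      ψ (outerPart n w) = 1 ∧ freeOrbitsHom n w = 1) :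
    Nat.card (cubeGroup n) * 2 ^ ((n / 2 - 1) * ((n + 1) / 2)) =
      Nat.card ψ.range * 2 ^ (n / 2 - 1) *
        Nat.factorial 24 ^ ((n / 2 - 1) * ((n + 1) / 2)) := by
  rw [← natCard_range_prod_freeOrbitsHom hn ψ hψ, cubeGroup, ← Subgroup.index_ker,
    ← Subgroup.index_ker]
  congr 2
  ext w
  rw [MonoidHom.mem_ker, MonoidHom.mem_ker, h, MonoidHom.prod_apply, Prod.mk_eq_one]
  rfl

theorem natCard_cubeGroup_of_odd {n : ℕ} (hn : 2 ≤ n) (ho : Odd n) :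
    Nat.card (cubeGroup n) * 2 ^ (((n - 3) / 2) ^ 2 + (n - 3) / 2 + 1) =
      Nat.factorial 8 * 3 ^ 7 * Nat.factorial 12 * 2 ^ 11 *
        Nat.factorial 24 ^ ((n - 3) * (n + 1) / 4) := by
  have key := natCard_cubeGroup_of_ker hn (cornerHom.prod edgeHom)
    (fun u hu => turnParity_eq_one_of_cornerHom_eq_one (Prod.mk_eq_one.1 hu).1) fun w => by
      rw [stickerPerm_eq_one_iff_freeOrbitsHom hn, MonoidHom.prod_apply, Prod.mk_eq_one]
      tauto
  obtain ⟨m, rfl⟩ : ∃ m, n = 2 * m + 3 := by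
    obtain ⟨k, rfl⟩ := ho
    exact ⟨k - 1, by omega⟩
  have e₁ : (2 * m + 3) / 2 - 1 = m := by omega
  have e₂ : (2 * m + 3 + 1) / 2 = m + 2 := by omega
  have e₃ : (2 * m + 3 - 3) / 2 = m := by omega
  have e₄ : (2 * m + 3 - 3) * (2 * m + 3 + 1) / 4 = m * (m + 2) := by
    rw [show (2 * m + 3 - 3) * (2 * m + 3 + 1) = 4 * (m * (m + 2)) by
      rw [Nat.add_sub_cancel]; ring]
    exact Nat.mul_div_cancel_left _ (by norm_num)
  rw [e₁, e₂] at key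
  rw [e₃, e₄]
  refine Nat.eq_of_mul_eq_mul_right (show 0 < 2 ^ m by positivity) ?_
  calc _ = Nat.card (cubeGroup (2 * m + 3)) * 2 ^ (m * (m + 2)) * 2 := by ring
    _ = Nat.card (cornerHom.prod edgeHom).range * 2 * 2 ^ m *
        Nat.factorial 24 ^ (m * (m + 2)) := by rw [key]; ring
    _ = _ := by rw [natCard_range_prod]; ring

theorem natCard_cubeGroup_of_even {n : ℕ} (hn : 2 ≤ n) (he : Even n) :
    Nat.card (cubeGroup n) * 2 ^ (((n - 2) / 2) ^ 2) =
      Nat.factorial 8 * 3 ^ 7 * Nat.factorial 24 ^ (n * (n - 2) / 4) := by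
  have key := natCard_cubeGroup_of_ker hn cornerHom
    (fun u hu => turnParity_eq_one_of_cornerHom_eq_one hu) fun w => by
      have : ¬Odd n := Nat.not_odd_iff_even.2 he
      rw [stickerPerm_eq_one_iff_freeOrbitsHom hn]
      tauto
  obtain ⟨m, rfl⟩ : ∃ m, n = 2 * m + 2 := by
    obtain ⟨k, rfl⟩ := he
    exact ⟨k - 1, by omega⟩
  have e₁ : (2 * m + 2) / 2 - 1 = m := by omega
  have e₂ : (2 * m + 2 + 1) / 2 = m + 1 := by omega
  have e₃ : (2 * m + 2 - 2) / 2 = m := by omega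
  have e₄ : (2 * m + 2) * (2 * m + 2 - 2) / 4 = m * (m + 1) := by
    rw [show (2 * m + 2) * (2 * m + 2 - 2) = 4 * (m * (m + 1)) by
      rw [Nat.add_sub_cancel]; ring]
    exact Nat.mul_div_cancel_left _ (by norm_num)
  rw [e₁, e₂] at key
  rw [e₃, e₄]
  refine Nat.eq_of_mul_eq_mul_right (show 0 < 2 ^ m by positivity) ?_
  calc _ = Nat.card (cubeGroup (2 * m + 2)) * 2 ^ (m * (m + 1)) := by ring
    _ = _ := by rw [key, natCard_range_cornerHom]; ring

theorem eq_one_of_smul_eq {n : ℕ} (s : Configurations n) (g : cubeGroup n) (h : g • s = s) :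
    g = 1 :=
  Subtype.ext (mul_eq_right.1 (congrArg Subtype.val h))

theorem natCard_configurations (n : ℕ) :
    Nat.card (Configurations n) = numOrbits n * Nat.card (cubeGroup n) := by
  -- The action is free, so each orbit has as many elements as the group.
  have h : ∀ s : Configurations n, MulAction.stabilizer (cubeGroup n) s = ⊥ := fun s =>
    (Subgroup.eq_bot_iff_forall _).2 fun g hg => eq_one_of_smul_eq s g hg
  rw [Nat.card_congr (MulAction.selfEquivOrbitsQuotientProd h), Nat.card_prod, numOrbits]

end RubiksCube

theorem mainTheorem3 (n : ℕ) (hn : 2 ≤ n) :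
    (Odd n →
      (Nat.card (RubiksCube.cubeGroup n) : ℚ) =
        (Nat.factorial 8 * 3 ^ 7 * Nat.factorial 12 * 2 ^ 11 *
            (Nat.factorial 24) ^ ((n - 3) * (n + 1) / 4)) /
          2 ^ (((n - 3) / 2) ^ 2 + (n - 3) / 2 + 1)) ∧
    (Even n →
      (Nat.card (RubiksCube.cubeGroup n) : ℚ) =
        (Nat.factorial 8 * 3 ^ 7 * (Nat.factorial 24) ^ (n * (n - 2) / 4)) /
          2 ^ (((n - 2) / 2) ^ 2)) ∧
    (∀ (s : RubiksCube.Configurations n) (g : RubiksCube.cubeGroup n), g • s = s → g = 1) ∧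
    (RubiksCube.numOrbits n : ℚ) =
      (Nat.card (RubiksCube.Configurations n) : ℚ) / Nat.card (RubiksCube.cubeGroup n) := by
  refine ⟨fun ho => ?_, fun he => ?_, RubiksCube.eq_one_of_smul_eq, ?_⟩
  · rw [eq_div_iff (by positivity)]
    simpa only [Nat.cast_mul, Nat.cast_pow, Nat.cast_ofNat] using
      congrArg (Nat.cast : ℕ → ℚ) (RubiksCube.natCard_cubeGroup_of_odd hn ho)
  · rw [eq_div_iff (by positivity)]
    simpa only [Nat.cast_mul, Nat.cast_pow, Nat.cast_ofNat] using
      congrArg (Nat.cast : ℕ → ℚ) (RubiksCube.natCard_cubeGroup_of_even hn he)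
  · rw [eq_div_iff (Nat.cast_ne_zero.2 Nat.card_pos.ne')]
    exact_mod_cast (RubiksCube.natCard_configurations n).symm
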